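/- For a prime $p$ let $k$ be an algebraically closed field containing $\mathbb{F}_{p^2}$, and let $C\subseteq\mathbb{P}^2$ be the Fermat curve $X_1^{p+1}+X_2^{p+1}+X_3^{p+1}=0$. Let $\mathcal{Q}$ be the set of all conics over $\mathbb{F}_{p^2}$, including degenerate ones, that is, of all nonzero quadratic forms in $\mathbb{F}_{p^2}[X_1,X_2,X_3]$ up to multiplication by $\mathbb{F}_{p^2}^\times$, and put $\Delta:=\bigcup_{Q\in\mathcal{Q}}Q$. Write $C\cap Q$ and $C\cap\Delta$ for the set-theoretic intersections of the sets of $k$-points in $\mathbb{P}^2(k)$. For $Q\in\mathcal{Q}$ and $t\in C\cap Q$ let $\mathrm{mult}_{C\cap Q}(t)$ be the intersection multiplicity of $C$ and $Q$ at $t$, and put \[ \varepsilon_{Q,r}:=\#\{t\in C\cap Q:\mathrm{mult}_{C\cap Q}(t)=r\}\cdot(r-1),\qquad \varepsilon_Q:=\sum_{r\ge 2}\varepsilon_{Q,r},\qquad \varepsilon:=\sum_{Q\in\mathcal{Q}}\varepsilon_Q . \] Then, for every prime $p$, all these multiplicities are finite, the set $C\cap\Delta$ is finite, and \[ |C\cap\Delta|=p^{11}+2p^8+2p^6+3p^5+p^4+2p^3+p^2+2p+2-\varepsilon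 . \] In particular, $|C\cap\Delta|=p^{11}+o(p^{11})-\varepsilon$ as $p\to\infty$ through the primes. -/

import Mathlib

open Filter Asymptotics

namespace FermatConics

open MvPolynomial

/-- The points of the projective plane `ℙ²(K)`. -/
abbrev Plane (K : Type*) [Field K] : Type _ := Projectivization K (Fin 3 → K)

/-- The zero locus in `ℙ²(K)` of a form `G` (it is only used for homogeneous `G`, for which the
choice of the representative does not matter). -/
def zeroLocus {K : Type*} [Field K] (G : MvPolynomial (Fin 3) K) : Set (Plane K) :=
  {t | eval t.rep G = 0}

/-- The Fermat form `X₁^(p+1) + X₂^(p+1) + X₃^(p+1)`. -/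
noncomputable def fermatForm (K : Type*) [Field K] (p : ℕ) : MvPolynomial (Fin 3) K :=
  ∑ i, X i ^ (p + 1)

/-- The `K`-points of the Fermat curve of degree `p + 1`. -/
def fermatCurve (K : Type*) [Field K] (p : ℕ) : Set (Plane K) :=
  zeroLocus (fermatForm K p)

/-- The conics over `F`, degenerate ones included: nonzero quadratic forms in three variables over
`F`, up to a nonzero scalar of `F`. -/
abbrev Conic (F : Type*) [Field F] : Type _ :=
  Projectivization F (homogeneousSubmodule (Fin 3) F 2)

/-- A quadratic form defining the conic `Q`, viewed over the extension `K` of `F`. -/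
noncomputable def Conic.form {F : Type*} [Field F] (K : Type*) [Field K] [Algebra F K]
    (Q : Conic F) : MvPolynomial (Fin 3) K :=
  MvPolynomial.map (algebraMap F K) (Q.rep : MvPolynomial (Fin 3) F)

/-- The `K`-points of the conic `Q`. -/
def Conic.points {F : Type*} [Field F] (K : Type*) [Field K] [Algebra F K]
    (Q : Conic F) : Set (Plane K) :=
  zeroLocus (Q.form K)

/-- `Δ`: the union in `ℙ²(K)` of all conics defined over `F`. -/
def conicUnion (F : Type*) [Field F] (K : Type*) [Field K] [Algebra F K] : Set (Plane K) :=
  ⋃ Q : Conic F, Q.points K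

/-- The homogeneous prime ideal of the point `t = (t₁ : t₂ : t₃)`: the kernel of
`K[X₁, X₂, X₃] → K[T]`, `Xᵢ ↦ tᵢ T`, which is generated by the forms that vanish at `t`. -/
noncomputable def pointIdeal {K : Type*} [Field K] (t : Plane K) :
    Ideal (MvPolynomial (Fin 3) K) :=
  RingHom.ker (aeval (fun i => Polynomial.C (t.rep i) * Polynomial.X) :
    MvPolynomial (Fin 3) K →ₐ[K] Polynomial K)

instance {K : Type*} [Field K] (t : Plane K) : (pointIdeal t).IsPrime :=
  RingHom.ker_isPrime _

/-- The intersection multiplicity at `t` of the plane curves `G = 0` and `H = 0`: the length of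
`(S / (G, H))_𝔭` over `S_𝔭`, where `S = K[X₁, X₂, X₃]` and `𝔭` is the homogeneous prime ideal of
`t`. -/
noncomputable def intersectionMult {K : Type*} [Field K] (G H : MvPolynomial (Fin 3) K)
    (t : Plane K) : ℕ∞ :=
  Module.length (Localization.AtPrime (pointIdeal t))
    (Localization.AtPrime (pointIdeal t) ⧸
      Ideal.span {algebraMap _ (Localization.AtPrime (pointIdeal t)) G,
        algebraMap _ (Localization.AtPrime (pointIdeal t)) H})

/-- `ε_{Q,r}`: the number of points of `C ∩ Q` at which `C` and `Q` meet with multiplicity `r`,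
times `r - 1`. -/
noncomputable def errorAt {F : Type*} [Field F] (K : Type*) [Field K] [Algebra F K] (p : ℕ)
    (Q : Conic F) (r : ℕ) : ℕ :=
  {t ∈ fermatCurve K p ∩ Q.points K |
    intersectionMult (fermatForm K p) (Q.form K) t = r}.ncard * (r - 1)

/-- `ε_Q = ∑_{r ≥ 2} ε_{Q,r}`. -/
noncomputable def conicError {F : Type*} [Field F] (K : Type*) [Field K] [Algebra F K] (p : ℕ)
    (Q : Conic F) : ℕ :=
  ∑ᶠ (r : ℕ) (_ : 2 ≤ r), errorAt K p Q r

/-- `ε = ∑_Q ε_Q`, the sum over all conics over `F`. -/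
noncomputable def totalError (F : Type*) [Field F] (K : Type*) [Field K] [Algebra F K]
    (p : ℕ) : ℕ :=
  ∑ᶠ Q : Conic F, conicError K p Q

instance (p : Nat.Primes) : Fact (p : ℕ).Prime := ⟨p.2⟩

end FermatConics

/-! Count the pairs (t, Q) with t in C ∩ Q in two ways. Write q = p², F for the field with q
elements and φ for the coordinatewise q-th power.

Over conics: Bézout gives |C ∩ Q| + ε_Q = 2(p + 1) for each Q (`ncard_inter_points_add_conicError`),
and there are 1 + q + ... + q⁵ conics. Bézout for the Fermat form G is proved by a norm argument.
Multiplicities add over products, and the substitutions `X 0 ↦ z * X 0` with z^(p+1) = 1 preserve G.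
The product of the images of a form H under them is congruent modulo G to a form in the other two
variables, which splits into lines, and modulo such a line G itself splits into p + 1 linear factors
(`totalMult_fermatForm`).

Over points: the conics through t form the projective space of the F-linear kernel of evaluation at
t, so only its dimension matters. A conic over F through t contains every φ-conjugate of t. The
tangent of C at t meets C only in t and φ(t). Hence products of two tangents at conjugates are
conics that separate the conjugates, and up to five distinct conjugates impose independent
conditions; the same tangent property excludes points of degree 2 over F. The kernel therefore has
dimension 5, 3, 2 at points of degree 1, 3, 4 and at most 1 at all others (`finrank_ker_of_one`,
`finrank_ker_of_three`, `finrank_ker_of_four`, `finrank_ker_le_one`). So every point of C ∩ Δ is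
counted once, apart from explicit excesses at degrees 1, 3 and 4.

The excesses need the number of points of C over the fields with p^(2n) elements for n = 1, 3, 4
(`ncard_rationalPoints`). A change of coordinates turns C into w^p + w + x^(p+1) = 0 with one point
at infinity. The affine count is that of the zeros of a quadratic-like function x ↦ μ(x^(p+1)) with
values in `ZMod p`; its second moment gives the count up to a sign, and a congruence modulo p + 1
fixes the sign. -/

namespace FermatConics

open MvPolynomial

/-! ### Colengths of two-generated ideals in localizations. -/

section LocalLength

/-- Additivity of the colength of `(G, H)` in `H`. -/
theorem length_quotient_span_pair_mul {R : Type*} [CommRing R] {G a : R} (b : R)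
    (h : ∀ x, a * x ∈ Ideal.span {G} → x ∈ Ideal.span {G}) :
    Module.length R (R ⧸ Ideal.span {G, a * b}) =
      Module.length R (R ⧸ Ideal.span {G, b}) + Module.length R (R ⧸ Ideal.span {G, a}) := by
  have hle : Ideal.span {G, a * b} ≤ Ideal.span {G, a} := by
    rw [Ideal.span_le]
    rintro x (rfl | rfl)
    · exact Ideal.subset_span (by simp)
    · exact Ideal.mul_mem_right _ _ (Ideal.subset_span (by simp))
  have hmap : Ideal.span {G, b} ≤ Submodule.comap (LinearMap.mulLeft R a) (Ideal.span {G, a * b}) := by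
    refine Submodule.span_le.2 ?_
    rintro x (rfl | rfl)
    · exact Ideal.mul_mem_left _ _ (Ideal.subset_span (by simp))
    · exact Ideal.subset_span (by simp)
  -- The sequence is 0 → R/(G, b) → R/(G, ab) → R/(G, a) → 0 with multiplication by `a` first;
  -- injectivity is `h`, that `a` is a nonzerodivisor modulo `G`.
  refine Module.length_eq_add_of_exact (Submodule.mapQ _ _ (LinearMap.mulLeft R a) hmap)
    (Submodule.factor hle) ?_ (Submodule.factor_surjective hle) ?_
  · rw [← LinearMap.ker_eq_bot, LinearMap.ker_eq_bot']
    intro x hx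
    induction x using Submodule.Quotient.induction_on with | _ x
    rw [Submodule.mapQ_apply, Submodule.Quotient.mk_eq_zero, LinearMap.mulLeft_apply,
      Ideal.mem_span_pair] at hx
    obtain ⟨c, d, hx⟩ := hx
    rw [Submodule.Quotient.mk_eq_zero]
    have : x - d * b ∈ Ideal.span {G} := h _ (Ideal.mem_span_singleton'.2 ⟨c, by
      linear_combination hx⟩)
    obtain ⟨e, he⟩ := Ideal.mem_span_singleton'.1 this
    exact Ideal.mem_span_pair.2 ⟨e, d, by linear_combination he⟩
  · intro x
    induction x using Submodule.Quotient.induction_on with | _ x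
    change (Submodule.Quotient.mk x : R ⧸ Ideal.span {G, a}) = 0 ↔ _
    rw [Submodule.Quotient.mk_eq_zero]
    constructor
    · intro hx
      obtain ⟨c, d, hx⟩ := Ideal.mem_span_pair.1 hx
      refine ⟨Submodule.Quotient.mk d, ?_⟩
      rw [Submodule.mapQ_apply, Submodule.Quotient.eq]
      exact Ideal.mem_span_pair.2 ⟨-c, 0, by
        simp only [LinearMap.mulLeft_apply]; linear_combination -hx⟩
    · rintro ⟨y, hy⟩
      induction y using Submodule.Quotient.induction_on with | _ y
      rw [Submodule.mapQ_apply, Submodule.Quotient.eq, LinearMap.mulLeft_apply] at hy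
      obtain ⟨c, d, hx⟩ := Ideal.mem_span_pair.1 (hle hy)
      exact Ideal.mem_span_pair.2 ⟨-c, y - d, by linear_combination -hx⟩

variable {S : Type*} [CommRing S]

/-- The colength of `(G, H)` in the localization at a prime. -/
noncomputable def localMult (P : Ideal S) [P.IsPrime] (G H : S) : ℕ∞ :=
  Module.length (Localization.AtPrime P)
    (Localization.AtPrime P ⧸ Ideal.span {algebraMap _ (Localization.AtPrime P) G,
        algebraMap _ (Localization.AtPrime P) H})

theorem localMult_comm (P : Ideal S) [P.IsPrime] (G H : S) :
    localMult P G H = localMult P H G := by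
  rw [localMult, localMult, Set.pair_comm]

/-- In this form the multiplicity visibly depends only on the ideal, and is preserved by
isomorphisms of ideal lattices. -/
theorem localMult_eq_coheight (P : Ideal S) [P.IsPrime] (G H : S) :
    localMult P G H = Order.coheight (Ideal.map (algebraMap S (Localization.AtPrime P))
      (Ideal.span {G, H})) := by
  rw [localMult, Module.length_quotient, Ideal.map_span, Set.image_pair]

theorem localMult_congr (P : Ideal S) [P.IsPrime] {G H G' H' : S}
    (h : Ideal.span {G, H} = Ideal.span {G', H'}) : localMult P G H = localMult P G' H' := by
  rw [localMult_eq_coheight, localMult_eq_coheight, h]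

theorem localMult_congr_of_dvd_sub (P : Ideal S) [P.IsPrime] {G H H' : S}
    (h : G ∣ H - H') : localMult P G H = localMult P G H' := by
  apply localMult_congr
  obtain ⟨c, hc⟩ := h
  rw [← Ideal.span_pair_add_mul_left (x := G) (y := H') c,
    show H = H' + c * G by linear_combination hc]

theorem localMult_eq_zero_iff (P : Ideal S) [P.IsPrime] (G H : S) :
    localMult P G H = 0 ↔ G ∉ P ∨ H ∉ P := by
  rw [localMult, Module.length_eq_zero_iff, Submodule.Quotient.subsingleton_iff,
    ← Set.image_pair, ← Ideal.map_span]
  constructor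
  · intro h
    by_contra! hc
    have hle : Ideal.span {G, H} ≤ P := by
      rw [Ideal.span_le]
      rintro x (rfl | rfl)
      exacts [hc.1, hc.2]
    have := Ideal.map_mono (f := algebraMap S (Localization.AtPrime P)) hle
    rw [h, Localization.AtPrime.map_eq_maximalIdeal, top_le_iff] at this
    exact (IsLocalRing.maximalIdeal.isMaximal _).ne_top this
  · intro h
    refine IsLocalization.AtPrime.map_eq_top_of_not_le _ (p := P) fun hle => ?_
    rcases h with h | h
    · exact h (hle (Ideal.subset_span (by simp)))
    · exact h (hle (Ideal.subset_span (by simp)))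

/-- After clearing denominators, primality of `G` makes `a` a nonzerodivisor modulo `G` in the
localization, so the exact sequence above applies. -/
theorem localMult_mul (P : Ideal S) [P.IsPrime] {G a : S} (b : S) (hG : Prime G) (ha : ¬ G ∣ a) :
    localMult P G (a * b) = localMult P G a + localMult P G b := by
  rw [add_comm]
  unfold localMult
  rw [map_mul]
  apply length_quotient_span_pair_mul
  intro x hx
  obtain ⟨⟨x, s⟩, rfl⟩ := IsLocalization.mk'_surjective P.primeCompl x
  rw [← Set.image_singleton, ← Ideal.map_span] at hx ⊢
  rw [← IsLocalization.mk'_one (M := P.primeCompl), ← IsLocalization.mk'_mul,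
    IsLocalization.mk'_mem_map_algebraMap_iff] at hx
  rw [IsLocalization.mk'_mem_map_algebraMap_iff]
  obtain ⟨u, hu, hx⟩ := hx
  rw [Ideal.mem_span_singleton] at hx
  rcases hG.dvd_or_dvd hx with h | h
  · exact ⟨u, hu, Ideal.mem_span_singleton.2 (h.mul_right _)⟩
  · exact ⟨1, one_mem _, Ideal.mem_span_singleton.2
      (((hG.dvd_or_dvd h).resolve_left ha).mul_left _)⟩

/-- The quotient is the residue field. -/
theorem localMult_eq_one (P : Ideal S) [P.IsPrime] {G H : S} (h : P = Ideal.span {G, H}) :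
    localMult P G H = 1 := by
  rw [localMult_eq_coheight, ← h, Localization.AtPrime.map_eq_maximalIdeal, ← Module.length_quotient,
    Module.length_eq_one_iff, isSimpleModule_iff_isCoatom]
  exact (IsLocalRing.maximalIdeal.isMaximal _).out

theorem localMult_comap (e : S ≃+* S) (P P' : Ideal S) [P.IsPrime] [P'.IsPrime]
    (h : P = P'.comap e) (G H : S) : localMult P G H = localMult P' (e G) (e H) := by
  subst h
  let E := IsLocalization.ringEquivOfRingEquiv
    (Localization.AtPrime (P'.comap e)) (Localization.AtPrime P') e (e.map_primeCompl_comap_eq P')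
  have hE : ∀ x, E (algebraMap _ _ x) = algebraMap _ _ (e x) :=
    fun x => IsLocalization.ringEquivOfRingEquiv_eq _ _
  rw [localMult, localMult, Module.length_quotient, Module.length_quotient]
  rw [← Order.coheight_orderIso (E.symm.idealComapOrderIso)]
  congr 1
  rw [RingEquiv.idealComapOrderIso_apply]
  rw [Ideal.comap_symm, Ideal.map_span, Set.image_pair]
  simp [hE]

end LocalLength

/-! ### Ideals of points and vanishing of forms. -/

section PointIdeal

variable {K : Type*} [Field K]

theorem intersectionMult_eq_localMult (G H : MvPolynomial (Fin 3) K) (t : Plane K) :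
    intersectionMult G H t = localMult (pointIdeal t) G H := rfl

theorem aeval_C_mul_X_of_isHomogeneous {f : MvPolynomial (Fin 3) K} {n : ℕ}
    (hf : f.IsHomogeneous n) (v : Fin 3 → K) :
    aeval (fun i => Polynomial.C (v i) * Polynomial.X) f =
      Polynomial.C (eval v f) * Polynomial.X ^ n := by
  rw [f.as_sum, map_sum, map_sum, map_sum, Finset.sum_mul]
  refine Finset.sum_congr rfl fun d hd => ?_
  have hd' : d.degree = n := by
    rw [Finsupp.degree_eq_weight_one]; exact hf (mem_support_iff.1 hd)
  rw [aeval_monomial, eval_monomial, ← hd', Finsupp.degree_eq_sum]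
  rw [Finsupp.prod_fintype _ _ (by simp), Finsupp.prod_fintype _ _ (by simp)]
  simp only [mul_pow, Finset.prod_mul_distrib, Finset.prod_pow_eq_pow_sum, map_mul, map_prod,
    map_pow]
  rw [mul_assoc]
  rfl

theorem mem_pointIdeal_iff {f : MvPolynomial (Fin 3) K} {n : ℕ}
    (hf : f.IsHomogeneous n) (t : Plane K) : f ∈ pointIdeal t ↔ t ∈ zeroLocus f := by
  rw [pointIdeal, RingHom.mem_ker]
  rw [aeval_C_mul_X_of_isHomogeneous hf]
  simp [zeroLocus]

/-- Another representative changes the parametrization by the automorphism T ↦ aT of K[T], which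
does not affect the kernel. -/
theorem pointIdeal_mk (v : Fin 3 → K) (hv : v ≠ 0) :
    pointIdeal (Projectivization.mk K v hv) =
      RingHom.ker (aeval (fun i => Polynomial.C (v i) * Polynomial.X) :
        MvPolynomial (Fin 3) K →ₐ[K] Polynomial K) := by
  obtain ⟨a, ha⟩ := Projectivization.exists_smul_eq_mk_rep K v hv
  ext f
  have h : (aeval (fun i => Polynomial.C ((Projectivization.mk K v hv).rep i) * Polynomial.X) :
      MvPolynomial (Fin 3) K →ₐ[K] Polynomial K) =
      (Polynomial.aeval (Polynomial.C (a : K) * Polynomial.X)).comp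
      (aeval (fun i => Polynomial.C (v i) * Polynomial.X)) := by
    ext i
    simp only [← ha, Units.smul_def, Pi.smul_apply, smul_eq_mul, aeval_X, AlgHom.comp_apply,
      map_mul, Polynomial.aeval_X, Polynomial.aeval_C, Polynomial.algebraMap_eq]
    ring_nf
  rw [pointIdeal, h]
  have hinj : Function.Injective
      (Polynomial.aeval (R := K) (Polynomial.C (a : K) * Polynomial.X)) := by
    refine Function.LeftInverse.injective
      (g := Polynomial.aeval (R := K) (Polynomial.C ((a⁻¹ : Kˣ) : K) * Polynomial.X)) fun f => ?_
    rw [← AlgHom.comp_apply]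
    conv_rhs => rw [← AlgHom.id_apply (R := K) f]
    congr 1
    ext
    simp [← mul_assoc, ← Polynomial.C_mul]
  simp only [RingHom.mem_ker]
  change Polynomial.aeval _ (aeval _ f) = 0 ↔ aeval _ f = 0
  rw [map_eq_zero_iff _ hinj]

theorem mk_mem_zeroLocus_iff {f : MvPolynomial (Fin 3) K} {n : ℕ}
    (hf : f.IsHomogeneous n) (v : Fin 3 → K) (hv : v ≠ 0) :
    Projectivization.mk K v hv ∈ zeroLocus f ↔ eval v f = 0 := by
  rw [← mem_pointIdeal_iff hf, pointIdeal_mk, RingHom.mem_ker]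
  change aeval _ f = 0 ↔ _
  rw [aeval_C_mul_X_of_isHomogeneous hf]
  simp

theorem intersectionMult_ne_zero_iff {G H : MvPolynomial (Fin 3) K} {m n : ℕ}
    (hG : G.IsHomogeneous m) (hH : H.IsHomogeneous n) (t : Plane K) :
    intersectionMult G H t ≠ 0 ↔ t ∈ zeroLocus G ∩ zeroLocus H := by
  rw [intersectionMult_eq_localMult, ne_eq, localMult_eq_zero_iff, mem_pointIdeal_iff hG,
    mem_pointIdeal_iff hH, Set.mem_inter_iff]
  tauto

end PointIdeal
-- Irreducibility of the Fermat form.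
section Fermat

variable {K : Type*} [Field K]

theorem isHomogeneous_fermatForm (K : Type*) [Field K] (p : ℕ) :
    (fermatForm K p).IsHomogeneous (p + 1) :=
  IsHomogeneous.sum _ _ _ fun i _ => by simpa using (isHomogeneous_X K i).pow (p + 1)

theorem finSuccEquiv_fermatForm (p : ℕ) :
    finSuccEquiv K 2 (fermatForm K p) =
      Polynomial.X ^ (p + 1) + Polynomial.C (X 0 ^ (p + 1) + X 1 ^ (p + 1)) := by
  rw [fermatForm, map_sum, Fin.sum_univ_succ, Fin.sum_univ_two]
  simp only [map_pow, finSuccEquiv_X_zero, finSuccEquiv_X_succ, map_add]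

/-- Eisenstein's criterion in the first variable, at the kernel of restriction to a line on which
the sum of the other two powers vanishes. -/
theorem prime_fermatForm [IsAlgClosed K] {p : ℕ} (hp : ((p + 1 : ℕ) : K) ≠ 0) :
    Prime (fermatForm K p) := by
  rw [← irreducible_iff_prime, ← MulEquiv.irreducible_iff (finSuccEquiv K 2),
    finSuccEquiv_fermatForm]
  obtain ⟨ω, hω⟩ := IsAlgClosed.exists_pow_nat_eq (-1 : K) p.succ_pos
  have hω0 : ω ≠ 0 := by
    rintro rfl
    simp at hω
  let φ : MvPolynomial (Fin 2) K →ₐ[K] Polynomial K :=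
    aeval ![Polynomial.C ω * Polynomial.X, Polynomial.X]
  have hφ0 : φ (X 0) = Polynomial.C ω * Polynomial.X := by simp [φ]
  have hφ1 : φ (X 1) = Polynomial.X := by simp [φ]
  have hP : (RingHom.ker φ).IsPrime := RingHom.ker_isPrime φ
  have hmonic : (Polynomial.X ^ (p + 1) +
      Polynomial.C (X 0 ^ (p + 1) + X 1 ^ (p + 1) : MvPolynomial (Fin 2) K)).Monic :=
    Polynomial.monic_X_pow_add_C _ p.succ_ne_zero
  have hdeg : (Polynomial.X ^ (p + 1) +
      Polynomial.C (X 0 ^ (p + 1) + X 1 ^ (p + 1) : MvPolynomial (Fin 2) K)).degree =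
      ((p + 1 : ℕ) : WithBot ℕ) :=
    Polynomial.degree_X_pow_add_C p.succ_pos _
  have hmem : (X 0 ^ (p + 1) + X 1 ^ (p + 1) : MvPolynomial (Fin 2) K) ∈ RingHom.ker φ := by
    rw [RingHom.mem_ker, map_add, map_pow, map_pow, hφ0, hφ1, mul_pow, ← Polynomial.C_pow,
      show ω ^ (p + 1) = -1 from hω]
    simp
  refine Polynomial.irreducible_of_eisenstein_criterion hP ?_ ?_ ?_ ?_ hmonic.isPrimitive
  · rw [hmonic.leadingCoeff]
    exact fun h => hP.ne_top ((Ideal.eq_top_iff_one _).2 h)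
  · intro n hn
    rw [hdeg] at hn
    have hn : n < p + 1 := by exact_mod_cast hn
    rw [Polynomial.coeff_add, Polynomial.coeff_X_pow, if_neg hn.ne, zero_add, Polynomial.coeff_C]
    split_ifs
    · exact hmem
    · exact zero_mem _
  · rw [hdeg]
    exact_mod_cast p.succ_pos
  · rw [Polynomial.coeff_add, Polynomial.coeff_X_pow, if_neg (Nat.succ_ne_zero p).symm, zero_add,
      Polynomial.coeff_C_zero]
    intro h
    -- Derivatives map the square of an ideal into the ideal, while the derivative of the constant
    -- term restricts to a nonzero multiple of the p-th power, by `hp`.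
    have key : ∀ f ∈ RingHom.ker φ ^ 2, pderiv (0 : Fin 2) f ∈ RingHom.ker φ := by
      intro f hf
      rw [pow_two] at hf
      refine Submodule.mul_induction_on hf (fun a ha b hb => ?_) (fun a b ha hb => ?_)
      · rw [Derivation.leibniz]
        exact add_mem (Ideal.mul_mem_right _ _ ha) (Ideal.mul_mem_right _ _ hb)
      · rw [map_add]
        exact add_mem ha hb
    have h1 := key _ h
    have h10 : (1 : Fin 2) ≠ 0 := by decide
    rw [RingHom.mem_ker, map_add, Derivation.leibniz_pow, Derivation.leibniz_pow, pderiv_X_self,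
      pderiv_X_of_ne h10] at h1
    simp only [Nat.add_sub_cancel, smul_eq_mul, mul_one, nsmul_eq_mul, mul_zero, add_zero] at h1
    rw [map_mul, map_natCast, map_pow, hφ0, mul_pow] at h1
    refine mul_ne_zero ?_ (mul_ne_zero ?_ ?_) h1
    · exact_mod_cast (map_ne_zero_iff _ Polynomial.C_injective).2 hp
    · exact pow_ne_zero _ (by simpa using hω0)
    · exact pow_ne_zero _ Polynomial.X_ne_zero

end Fermat

end FermatConics

namespace FermatConics

open MvPolynomial

/-! ### Bézout's theorem for the Fermat curve. -/

section Bezout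

open scoped ENNReal

variable {K : Type*} [Field K]

/-- The sum of the intersection multiplicities of two plane curves over all points. -/
noncomputable def totalMult (G H : MvPolynomial (Fin 3) K) : ℝ≥0∞ :=
  ∑' t : Plane K, ((intersectionMult G H t : ℕ∞) : ℝ≥0∞)

theorem totalMult_comm (G H : MvPolynomial (Fin 3) K) : totalMult G H = totalMult H G := by
  simp only [totalMult, intersectionMult_eq_localMult, localMult_comm _ G H]

theorem totalMult_mul {G a : MvPolynomial (Fin 3) K} (b : MvPolynomial (Fin 3) K)
    (hG : Prime G) (ha : ¬ G ∣ a) : totalMult G (a * b) = totalMult G a + totalMult G b := by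
  simp only [totalMult, intersectionMult_eq_localMult, localMult_mul _ b hG ha,
    ENat.toENNReal_add, ENNReal.tsum_add]

theorem totalMult_congr {G H H' : MvPolynomial (Fin 3) K} (h : G ∣ H - H') :
    totalMult G H = totalMult G H' := by
  simp only [totalMult, intersectionMult_eq_localMult, localMult_congr_of_dvd_sub _ h]

theorem totalMult_of_isUnit (G : MvPolynomial (Fin 3) K) {u : MvPolynomial (Fin 3) K}
    (hu : IsUnit u) : totalMult G u = 0 := by
  rw [totalMult, ENNReal.tsum_eq_zero]
  intro t
  rw [intersectionMult_eq_localMult, (localMult_eq_zero_iff _ _ _).2 (Or.inr fun h =>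
    (inferInstance : (pointIdeal t).IsPrime).ne_top (Ideal.eq_top_of_isUnit_mem _ h hu))]
  simp

theorem totalMult_prod {ι : Type*} {G : MvPolynomial (Fin 3) K} (hG : Prime G) (s : Finset ι)
    (f : ι → MvPolynomial (Fin 3) K) (hf : ∀ i ∈ s, ¬ G ∣ f i) :
    totalMult G (∏ i ∈ s, f i) = ∑ i ∈ s, totalMult G (f i) := by
  classical
  induction s using Finset.induction_on with
  | empty => simpa using totalMult_of_isUnit G isUnit_one
  | insert i s hi ih =>
    rw [Finset.prod_insert hi, Finset.sum_insert hi, totalMult_mul _ hG (hf i (by simp)),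
      ih fun j hj => hf j (Finset.mem_insert_of_mem hj)]

/-- Two lines that meet exactly in `v` have total intersection multiplicity one. -/
theorem totalMult_eq_one {L M s : MvPolynomial (Fin 3) K} {v : Fin 3 → K} (hv : v ≠ 0)
    (h : ∀ i, X i - C (v i) * s ∈ Ideal.span {L, M})
    (hL : L ∈ pointIdeal (Projectivization.mk K v hv))
    (hM : M ∈ pointIdeal (Projectivization.mk K v hv)) : totalMult L M = 1 := by
  have hP : pointIdeal (Projectivization.mk K v hv) = Ideal.span {L, M} := by
    apply le_antisymm
    -- By `h`, modulo (L, M) every `f` equals its restriction to the line spanned by `v`, evaluated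
    -- at T = s; a vanishing restriction puts `f` in (L, M).
    · intro f hf
      rw [pointIdeal_mk, RingHom.mem_ker] at hf
      have hcomp : (Ideal.Quotient.mkₐ K (Ideal.span {L, M})).comp
          ((Polynomial.aeval s).comp
            (aeval (fun i => Polynomial.C (v i) * Polynomial.X) :
              MvPolynomial (Fin 3) K →ₐ[K] Polynomial K)) =
          Ideal.Quotient.mkₐ K (Ideal.span {L, M}) := by
        ext i
        simp only [AlgHom.comp_apply, aeval_X, map_mul (Polynomial.aeval s), Polynomial.aeval_C,
          Polynomial.aeval_X, Ideal.Quotient.mkₐ_eq_mk, algebraMap_eq]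
        rw [eq_comm, Ideal.Quotient.eq]
        exact h i
      have := DFunLike.congr_fun hcomp f
      rw [AlgHom.comp_apply, AlgHom.comp_apply, hf, map_zero, map_zero, eq_comm,
        Ideal.Quotient.mkₐ_eq_mk, Ideal.Quotient.eq_zero_iff_mem] at this
      exact this
    · rw [Ideal.span_le]
      rintro x (rfl | rfl)
      exacts [hL, hM]
  rw [totalMult, tsum_eq_single (Projectivization.mk K v hv)]
  · rw [intersectionMult_eq_localMult, localMult_eq_one _ hP]
    simp
  · intro t ht
    rw [intersectionMult_eq_localMult, (localMult_eq_zero_iff _ _ _).2]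
    · simp
    by_contra! hc
    have hle : Ideal.span {L, M} ≤ pointIdeal t := by
      rw [Ideal.span_le]
      rintro x (rfl | rfl)
      exacts [hc.1, hc.2]
    apply ht
    rw [← Projectivization.mk_rep t, Projectivization.mk_eq_mk_iff']
    -- Restricting `X i - v i * s` to the line of `t` and comparing coefficients of T shows that
    -- `t.rep` is this scalar times `v`.
    refine ⟨(aeval (fun i => Polynomial.C (t.rep i) * Polynomial.X) s).coeff 1, ?_⟩
    ext i
    have := hle (h i)
    rw [pointIdeal, RingHom.mem_ker, map_sub, map_mul, aeval_X, ← algebraMap_eq,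
      AlgHom.commutes, sub_eq_zero, Polynomial.algebraMap_eq] at this
    have := congrArg (fun f => Polynomial.coeff f 1) this
    simp only [Polynomial.coeff_C_mul, Polynomial.coeff_X_one, mul_one] at this
    rw [this, Pi.smul_apply, smul_eq_mul, mul_comm]

theorem prime_of_isHomogeneous_one {L : MvPolynomial (Fin 3) K} (hL : L.IsHomogeneous 1)
    (h0 : L ≠ 0) : Prime L := by
  rw [← irreducible_iff_prime]
  refine irreducible_of_totalDegree_eq_one (hL.totalDegree h0) fun x hx => ?_
  obtain ⟨d, hd⟩ := ne_zero_iff.1 h0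
  rw [isUnit_iff_ne_zero]
  rintro rfl
  exact hd (zero_dvd_iff.1 (hx d))

theorem finSuccEquiv_rename_succ (B : MvPolynomial (Fin 2) K) :
    finSuccEquiv K 2 (rename Fin.succ B) = Polynomial.C B := by
  induction B using MvPolynomial.induction_on with
  | C a => simp [finSuccEquiv_apply]
  | add f g hf hg => simp [hf, hg]
  | mul_X f i hf => simp [hf, finSuccEquiv_X_succ]

theorem not_fermatForm_dvd_rename {p : ℕ} {B : MvPolynomial (Fin 2) K} (hB : B ≠ 0) :
    ¬ fermatForm K p ∣ rename Fin.succ B := by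
  intro h
  have := map_dvd (finSuccEquiv K 2) h
  rw [finSuccEquiv_fermatForm, finSuccEquiv_rename_succ] at this
  have := Polynomial.natDegree_le_of_dvd this (Polynomial.C_ne_zero.2 hB)
  rw [Polynomial.natDegree_X_pow_add_C, Polynomial.natDegree_C] at this
  omega

/-- The substitution `X₀ ↦ z X₀`. -/
noncomputable def scaleHom (z : K) : MvPolynomial (Fin 3) K →ₐ[K] MvPolynomial (Fin 3) K :=
  aeval ![C z * X 0, X 1, X 2]

theorem scaleHom_scaleHom (z w : K) (f : MvPolynomial (Fin 3) K) :
    scaleHom z (scaleHom w f) = scaleHom (w * z) f := by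
  rw [← AlgHom.comp_apply]
  congr 1
  ext1 i
  fin_cases i <;> simp [scaleHom, mul_assoc]

theorem scaleHom_one (f : MvPolynomial (Fin 3) K) : scaleHom 1 f = f := by
  have : scaleHom (1 : K) = AlgHom.id K _ := by
    ext1 i
    fin_cases i <;> simp [scaleHom]
  rw [this, AlgHom.id_apply]

theorem scaleHom_fermatForm {p : ℕ} {z : K} (hz : z ^ (p + 1) = 1) :
    scaleHom z (fermatForm K p) = fermatForm K p := by
  simp [scaleHom, fermatForm, Fin.sum_univ_three, mul_pow, ← C_pow, hz]

theorem isHomogeneous_scaleHom {f : MvPolynomial (Fin 3) K} {n : ℕ} (hf : f.IsHomogeneous n)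
    (z : K) : (scaleHom z f).IsHomogeneous n := by
  have := hf.aeval ![(C z * X 0 : MvPolynomial (Fin 3) K), X 1, X 2] (n := 1) fun i => by
    fin_cases i
    · simpa using (isHomogeneous_C (Fin 3) z).mul (isHomogeneous_X K (0 : Fin 3))
    · exact isHomogeneous_X K _
    · exact isHomogeneous_X K _
  simpa [scaleHom] using this

theorem finSuccEquiv_scaleHom (z : K) (f : MvPolynomial (Fin 3) K) :
    finSuccEquiv K 2 (scaleHom z f) =
      (finSuccEquiv K 2 f).comp (Polynomial.C (C z) * Polynomial.X) := by
  induction f using MvPolynomial.induction_on with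
  | C a => simp [finSuccEquiv_apply]
  | add f g hf hg => simp [hf, hg]
  | mul_X f i hf =>
    have hX : finSuccEquiv K 2 (scaleHom z (X i)) =
        (finSuccEquiv K 2 (X i)).comp (Polynomial.C (C z) * Polynomial.X) := by
      refine Fin.cases ?_ (fun i => ?_) i
      · simp [scaleHom, finSuccEquiv_apply]
      · have : scaleHom z (X i.succ) = X i.succ := by
          fin_cases i <;> simp [scaleHom]
        rw [this, finSuccEquiv_X_succ, Polynomial.C_comp]
    rw [map_mul (scaleHom z), map_mul (finSuccEquiv K 2), map_mul (finSuccEquiv K 2),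
      Polynomial.mul_comp, hf, hX]

/-- The linear automorphism `(v₀, v₁, v₂) ↦ (z v₀, v₁, v₂)`. -/
def scaleVec (z : K) : (Fin 3 → K) →ₗ[K] (Fin 3 → K) where
  toFun v := ![z * v 0, v 1, v 2]
  map_add' v w := by ext i; fin_cases i <;> simp [mul_add]
  map_smul' c v := by ext i; fin_cases i <;> simp [mul_left_comm]

theorem scaleVec_scaleVec {z w : K} (h : z * w = 1) (v : Fin 3 → K) :
    scaleVec z (scaleVec w v) = v := by
  ext i
  fin_cases i <;> simp [scaleVec, ← mul_assoc, h]

theorem scaleVec_injective {z w : K} (h : z * w = 1) : Function.Injective (scaleVec w) :=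
  Function.LeftInverse.injective (scaleVec_scaleVec h)

theorem intersectionMult_scaleHom {z w : K} (h : z * w = 1) (G H : MvPolynomial (Fin 3) K)
    (t : Plane K) : intersectionMult (scaleHom z G) (scaleHom z H) t =
      intersectionMult G H
        (Projectivization.map (scaleVec z) (scaleVec_injective (mul_comm w z ▸ h)) t) := by
  induction t using Projectivization.ind with | _ v hv
  let e : MvPolynomial (Fin 3) K ≃ₐ[K] MvPolynomial (Fin 3) K :=
    AlgEquiv.ofAlgHom (scaleHom z) (scaleHom w)
      (by ext1 i; simp [scaleHom_scaleHom, scaleHom_one, h, mul_comm w z])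
      (by ext1 i; simp [scaleHom_scaleHom, scaleHom_one, h])
  rw [Projectivization.map_mk, intersectionMult_eq_localMult, intersectionMult_eq_localMult]
  symm
  refine localMult_comap e.toRingEquiv _ _ ?_ G H
  ext f
  rw [Ideal.mem_comap, pointIdeal_mk, pointIdeal_mk, RingHom.mem_ker, RingHom.mem_ker]
  change _ ↔ aeval _ (scaleHom z f) = 0
  rw [← AlgHom.comp_apply]
  have : (aeval (fun i => Polynomial.C (scaleVec z v i) * Polynomial.X) :
      MvPolynomial (Fin 3) K →ₐ[K] Polynomial K) =
      (aeval (fun i => Polynomial.C (v i) * Polynomial.X)).comp (scaleHom z) := by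
    ext1 i
    fin_cases i <;> simp [scaleHom, scaleVec, mul_assoc]
  rw [this]

/-- The scaling is a projective automorphism that preserves the Fermat form, so it only permutes the
points summed over. -/
theorem totalMult_scaleHom {p : ℕ} {z : K} (hz : z ^ (p + 1) = 1) (H : MvPolynomial (Fin 3) K) :
    totalMult (fermatForm K p) (scaleHom z H) = totalMult (fermatForm K p) H := by
  have h : z * z ^ p = 1 := by rw [← pow_succ', hz]
  conv_lhs => rw [← scaleHom_fermatForm hz]
  simp only [totalMult, intersectionMult_scaleHom h]
  let e : Plane K ≃ Plane K :=
    { toFun := Projectivization.map (scaleVec z) (scaleVec_injective (mul_comm (z ^ p) z ▸ h))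
      invFun := Projectivization.map (scaleVec (z ^ p)) (scaleVec_injective h)
      left_inv := fun t => by
        induction t using Projectivization.ind with | _ v hv
        simp only [Projectivization.map_mk, scaleVec_scaleVec (mul_comm (z ^ p) z ▸ h)]
      right_inv := fun t => by
        induction t using Projectivization.ind with | _ v hv
        simp only [Projectivization.map_mk, scaleVec_scaleVec h] }
  exact e.tsum_eq fun t => ((intersectionMult (fermatForm K p) H t : ℕ∞) : ℝ≥0∞)

variable [IsAlgClosed K] {p : ℕ}

theorem exists_primitiveRoot (hp : ((p + 1 : ℕ) : K) ≠ 0) :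
    ∃ ζ : K, IsPrimitiveRoot ζ (p + 1) :=
  have : NeZero ((p + 1 : ℕ) : K) := ⟨hp⟩
  HasEnoughRootsOfUnity.exists_primitiveRoot K (p + 1)

theorem totalMult_fermatForm_line (hp : ((p + 1 : ℕ) : K) ≠ 0) {a b : K} (hab : a ≠ 0 ∨ b ≠ 0) :
    totalMult (fermatForm K p) (C a * X 1 + C b * X 2) = (p + 1 : ℕ) := by
  obtain ⟨ζ, hζ⟩ := exists_primitiveRoot hp
  have hpos : 0 < p + 1 := p.succ_pos
  set L : MvPolynomial (Fin 3) K := C a * X 1 + C b * X 2 with hLdef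
  have hLhom : L.IsHomogeneous 1 :=
    .add (by simpa using (isHomogeneous_C _ a).mul (isHomogeneous_X K (1 : Fin 3)))
      (by simpa using (isHomogeneous_C _ b).mul (isHomogeneous_X K (2 : Fin 3)))
  have hL0 : L ≠ 0 := by
    intro h
    have h1 := congrArg (eval ![0, 1, 0]) h
    have h2 := congrArg (eval ![0, 0, 1]) h
    simp [hLdef] at h1 h2
    tauto
  have hLp : Prime L := prime_of_isHomogeneous_one hLhom hL0
  -- The determinant condition makes `L` and `s` a basis of the linear forms in `X 1`, `X 2`; modulo
  -- `L` these variables become b s and -a s.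
  obtain ⟨c, d, hcd⟩ : ∃ c d : K, c * b - d * a = 1 := by
    rcases hab with h | h
    · exact ⟨0, -a⁻¹, by field_simp; ring⟩
    · exact ⟨b⁻¹, 0, by field_simp; ring⟩
  set s : MvPolynomial (Fin 3) K := C c * X 1 + C d * X 2 with hs
  have hC : (C c * C b - C d * C a : MvPolynomial (Fin 3) K) = 1 := by
    rw [← C_mul, ← C_mul, ← C_sub, hcd, C_1]
  have h1 : (X 1 : MvPolynomial (Fin 3) K) - C b * s = - C d * L := by
    rw [hs, hLdef]; linear_combination (-X 1) * hC
  have h2 : (X 2 : MvPolynomial (Fin 3) K) - C (-a) * s = C c * L := by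
    rw [hs, hLdef, C_neg]; linear_combination (-X 2) * hC
  -- Modulo `L` the Fermat form becomes `X 0 ^ (p + 1) - (γ s) ^ (p + 1)`, a product over roots of
  -- unity. If γ = 0 the factors coincide, but the sum over factors still counts p + 1.
  obtain ⟨γ, hγ⟩ := IsAlgClosed.exists_pow_nat_eq (-(b ^ (p + 1) + (-a) ^ (p + 1))) hpos
  have hprod : L ∣ fermatForm K p -
      ∏ z ∈ Polynomial.nthRootsFinset (p + 1) (1 : MvPolynomial (Fin 3) K),
        (X 0 - z * (C γ * s)) := by
    rw [← (hζ.map_of_injective (C_injective (Fin 3) K)).pow_sub_pow_eq_prod_sub_mul _ _ hpos,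
      mul_pow, ← C_pow, hγ, fermatForm, Fin.sum_univ_three]
    have e1 := (Dvd.intro_left _ h1.symm).trans (sub_dvd_pow_sub_pow (X 1) (C b * s) (p + 1))
    have e2 := (Dvd.intro_left _ h2.symm).trans (sub_dvd_pow_sub_pow (X 2) (C (-a) * s) (p + 1))
    have := dvd_add e1 e2
    rw [mul_pow, mul_pow] at this
    convert this using 1
    simp only [C_neg, C_add, C_pow]
    ring
  rw [totalMult_comm, totalMult_congr hprod, totalMult_prod hLp]
  · rw [Finset.sum_congr rfl (g := fun _ => 1), Finset.sum_const,
      (hζ.map_of_injective (C_injective (Fin 3) K)).card_nthRootsFinset, nsmul_eq_mul, mul_one]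
    intro z hz
    rw [Polynomial.mem_nthRootsFinset hpos] at hz
    obtain ⟨r, -, rfl⟩ := isUnit_iff_eq_C_of_isReduced.1 (IsUnit.of_pow_eq_one hz p.succ_ne_zero)
    have hv : (![r * γ, b, -a] : Fin 3 → K) ≠ 0 := by
      intro h
      have h1 := congrFun h 1
      have h2 := congrFun h 2
      simp at h1 h2
      tauto
    refine totalMult_eq_one (s := s) hv ?_ ?_ ?_
    · intro i
      fin_cases i
      · exact Ideal.mem_span_pair.2 ⟨0, 1, by simp; ring⟩
      · exact Ideal.mem_span_pair.2 ⟨-C d, 0, by simpa using h1.symm⟩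
      · exact Ideal.mem_span_pair.2 ⟨C c, 0, by simpa using h2.symm⟩
    · rw [mem_pointIdeal_iff hLhom, mk_mem_zeroLocus_iff hLhom]
      simp [hLdef]
      ring
    · have hMhom : (X 0 - C r * (C γ * s) : MvPolynomial (Fin 3) K).IsHomogeneous 1 := by
        rw [hs]
        refine (isHomogeneous_X K _).sub ?_
        rw [← mul_assoc, ← C_mul]
        simpa using (isHomogeneous_C (Fin 3) (r * γ)).mul
          (.add (by simpa using (isHomogeneous_C _ c).mul (isHomogeneous_X K (1 : Fin 3)))
            (by simpa using (isHomogeneous_C _ d).mul (isHomogeneous_X K (2 : Fin 3))) :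
            (C c * X 1 + C d * X 2 : MvPolynomial (Fin 3) K).IsHomogeneous 1)
      rw [mem_pointIdeal_iff hMhom, mk_mem_zeroLocus_iff hMhom]
      simp [hs]
      linear_combination (-r * γ) * hcd
  · rintro z - ⟨f, hf⟩
    have := congrArg (eval ![1, 0, 0]) hf
    simp [hLdef, hs] at this

/-- Linear factors are split off one at a time: a root of `f` gives a line, and when `f` is constant
the remaining formal degree gives copies of the line `X 2`. -/
theorem totalMult_fermatForm_homogenize (hp : ((p + 1 : ℕ) : K) ≠ 0) (d : ℕ) (f : Polynomial K)
    (hf : f ≠ 0) (hd : f.natDegree ≤ d) :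
    totalMult (fermatForm K p) (rename Fin.succ (f.homogenize d)) = (d * (p + 1) : ℕ) := by
  induction d generalizing f with
  | zero =>
    rw [Polynomial.eq_C_of_natDegree_eq_zero (Nat.le_zero.1 hd)] at hf ⊢
    rw [Polynomial.homogenize_C, pow_zero, mul_one, rename_C, totalMult_of_isUnit]
    · simp
    · exact (isUnit_iff_ne_zero.2 (Polynomial.C_ne_zero.1 hf)).map C
  | succ d ih =>
    have step : ∀ (l g : Polynomial K), l ≠ 0 → g ≠ 0 → l.natDegree ≤ 1 → g.natDegree ≤ d →
        f.homogenize (d + 1) = l.homogenize 1 * g.homogenize d →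
        totalMult (fermatForm K p) (rename Fin.succ (l.homogenize 1)) = (p + 1 : ℕ) →
        totalMult (fermatForm K p) (rename Fin.succ (f.homogenize (d + 1))) =
          ((d + 1) * (p + 1) : ℕ) := by
      intro l g hl hg hl1 hgd hfg hT
      rw [hfg, map_mul, totalMult_mul _ (prime_fermatForm hp), hT, ih g hg hgd]
      · push_cast; ring
      · exact not_fermatForm_dvd_rename fun h =>
          hl (Polynomial.eq_zero_of_homogenize_eq_zero hl1 h)
    by_cases h0 : f.natDegree = 0
    · obtain ⟨c, rfl⟩ := Polynomial.natDegree_eq_zero.1 h0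
      refine step 1 (Polynomial.C c) one_ne_zero hf (by simp) (by simp) ?_ ?_
      · rw [Polynomial.homogenize_C, Polynomial.homogenize_C, Polynomial.homogenize_one]; ring
      · have := totalMult_fermatForm_line hp (a := 0) (b := 1) (by simp)
        simpa [Polynomial.homogenize_one] using this
    · obtain ⟨r, hr⟩ := IsAlgClosed.exists_root f fun h => h0 (Polynomial.natDegree_eq_of_degree_eq_some h)
      obtain ⟨g, rfl⟩ := Polynomial.dvd_iff_isRoot.2 hr
      have hg : g ≠ 0 := right_ne_zero_of_mul hf
      rw [Polynomial.natDegree_mul (Polynomial.X_sub_C_ne_zero r) hg,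
        Polynomial.natDegree_X_sub_C] at hd
      refine step (Polynomial.X - Polynomial.C r) g (Polynomial.X_sub_C_ne_zero r) hg
        (Polynomial.natDegree_X_sub_C r).le (by omega) ?_ ?_
      · rw [add_comm d 1, Polynomial.homogenize_mul _ _ (Polynomial.natDegree_X_sub_C r).le
          (by omega)]
      · have := totalMult_fermatForm_line hp (a := 1) (b := -r) (by simp)
        rw [Polynomial.homogenize_sub, Polynomial.homogenize_X one_ne_zero,
          Polynomial.homogenize_C]
        convert this using 2
        simp
        ring

theorem totalMult_fermatForm_binary (hp : ((p + 1 : ℕ) : K) ≠ 0) {d : ℕ}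
    {B : MvPolynomial (Fin 2) K} (hB : B.IsHomogeneous d) (h0 : B ≠ 0) :
    totalMult (fermatForm K p) (rename Fin.succ B) = (d * (p + 1) : ℕ) := by
  have hdeg : (aeval ![Polynomial.X, 1] B : Polynomial K).natDegree ≤ d := by
    rw [B.as_sum, map_sum]
    refine Polynomial.natDegree_sum_le_of_forall_le _ _ fun e he => ?_
    have he' : e.degree = d := by
      rw [Finsupp.degree_eq_weight_one]; exact hB (mem_support_iff.1 he)
    rw [aeval_monomial, Finsupp.prod_fintype _ _ (by simp), Fin.prod_univ_two]
    refine (Polynomial.natDegree_C_mul_le _ _).trans ?_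
    rw [Finsupp.degree_eq_sum, Fin.sum_univ_two] at he'
    simp
    omega
  have h := Polynomial.homogenize_eq_of_isHomogeneous hB rfl
  rw [← h]
  refine totalMult_fermatForm_homogenize hp d _ ?_ hdeg
  intro hz
  rw [hz, Polynomial.homogenize_zero] at h
  exact h0 h.symm

/-- The norm of a form with respect to `X₀`, modulo the Fermat form. -/
theorem exists_binary_norm (hp : ((p + 1 : ℕ) : K) ≠ 0) {n : ℕ} {H : MvPolynomial (Fin 3) K}
    (hH : H.IsHomogeneous n) :
    ∃ B : MvPolynomial (Fin 2) K, B.IsHomogeneous (n * (p + 1)) ∧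
      fermatForm K p ∣ (∏ z ∈ Polynomial.nthRootsFinset (p + 1) (1 : K), scaleHom z H) -
        rename Fin.succ B := by
  obtain ⟨ζ, hζ⟩ := exists_primitiveRoot hp
  have hpos : 0 < p + 1 := p.succ_pos
  set N := ∏ z ∈ Polynomial.nthRootsFinset (p + 1) (1 : K), scaleHom z H with hN
  have hNhom : N.IsHomogeneous (n * (p + 1)) := by
    have := IsHomogeneous.prod (Polynomial.nthRootsFinset (p + 1) (1 : K))
      (fun z => scaleHom z H) (fun _ => n) fun z _ => isHomogeneous_scaleHom hH z
    rwa [Finset.sum_const, hζ.card_nthRootsFinset, smul_eq_mul, mul_comm] at this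
  have hinv : scaleHom ζ N = N := by
    rw [hN, map_prod]
    refine Finset.prod_bij (fun z _ => z * ζ) ?_ ?_ ?_ ?_
    · intro z hz
      rw [Polynomial.mem_nthRootsFinset hpos] at hz ⊢
      rw [mul_pow, hz, hζ.pow_eq_one, one_mul]
    · intro a _ b _ h
      exact mul_right_cancel₀ (hζ.ne_zero hpos.ne') h
    · intro z hz
      rw [Polynomial.mem_nthRootsFinset hpos] at hz
      refine ⟨z * ζ⁻¹, ?_, ?_⟩
      · rw [Polynomial.mem_nthRootsFinset hpos, mul_pow, hz, inv_pow, hζ.pow_eq_one, inv_one,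
          one_mul]
      · exact inv_mul_cancel_right₀ (hζ.ne_zero hpos.ne') z
    · intro z _
      rw [scaleHom_scaleHom]
  set R := finSuccEquiv K 2 N with hR
  -- The substitution by ζ multiplies the coefficient of the i-th power by ζ^i, so invariance leaves
  -- only exponents divisible by p + 1.
  have hcoeff : ∀ i, ¬ (p + 1) ∣ i → R.coeff i = 0 := by
    intro i hi
    have h1 := congrArg (fun f => Polynomial.coeff (finSuccEquiv K 2 f) i) hinv
    simp only [finSuccEquiv_scaleHom, Polynomial.comp_C_mul_X_coeff] at h1
    rw [← hR] at h1
    have h2 : R.coeff i * (C (ζ ^ i - 1)) = 0 := by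
      rw [C_sub, C_1, C_pow, mul_sub, h1, mul_one, sub_self]
    refine (mul_eq_zero.1 h2).resolve_right ?_
    rw [C_eq_zero, sub_eq_zero]
    exact fun h => hi (hζ.dvd_of_pow_eq_one i h)
  set c : MvPolynomial (Fin 2) K := X 0 ^ (p + 1) + X 1 ^ (p + 1) with hc
  have hchom : c.IsHomogeneous (p + 1) :=
    .add (by simpa using (isHomogeneous_X K (0 : Fin 2)).pow (p + 1))
      (by simpa using (isHomogeneous_X K (1 : Fin 2)).pow (p + 1))
  -- The witness is `N` with `X 0 ^ (p + 1)` replaced by `-c`, its value modulo the Fermat form; the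
  -- degree n(p + 1) of `N` bounds j by n.
  refine ⟨∑ j ∈ Finset.range (n + 1), R.coeff ((p + 1) * j) * (-c) ^ j, ?_, ?_⟩
  · refine IsHomogeneous.sum _ _ _ fun j hj => ?_
    have hj : j ≤ n := Nat.lt_succ_iff.1 (Finset.mem_range.1 hj)
    have h1 := hNhom.finSuccEquiv_coeff_isHomogeneous ((p + 1) * j) ((n - j) * (p + 1)) (by
      rw [mul_comm, ← add_mul, Nat.add_sub_cancel' hj])
    have h2 := h1.mul (hchom.neg.pow j)
    convert h2 using 1
    rw [mul_comm (p + 1) j, ← add_mul, Nat.sub_add_cancel hj]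
  · rw [← map_dvd_iff (finSuccEquiv K 2), map_sub, finSuccEquiv_rename_succ,
      finSuccEquiv_fermatForm, ← hR, ← hc]
    have hdeg : R.natDegree < (p + 1) * (n + 1) := by
      rw [hR, natDegree_finSuccEquiv]
      refine (degreeOf_le_totalDegree _ _).trans_lt (hNhom.totalDegree_le.trans_lt ?_)
      nlinarith
    have hRsum : R = ∑ j ∈ Finset.range (n + 1),
        Polynomial.C (R.coeff ((p + 1) * j)) * (Polynomial.X ^ (p + 1)) ^ j := by
      ext1 i
      simp only [Polynomial.finsetSum_coeff, Polynomial.coeff_C_mul, ← pow_mul,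
        Polynomial.coeff_X_pow]
      by_cases hi : (p + 1) ∣ i
      · obtain ⟨j, rfl⟩ := hi
        by_cases hj : j < n + 1
        · rw [Finset.sum_eq_single j]
          · simp
          · intro b _ hb
            rw [if_neg, mul_zero]
            exact fun h => hb (Nat.eq_of_mul_eq_mul_left hpos h).symm
          · intro h
            exact absurd (Finset.mem_range.2 hj) h
        · rw [Polynomial.coeff_eq_zero_of_natDegree_lt, Finset.sum_eq_zero]
          · intro b hb
            rw [if_neg, mul_zero]
            intro h
            have := Nat.eq_of_mul_eq_mul_left hpos h
            rw [Finset.mem_range] at hb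
            omega
          · exact hdeg.trans_le (Nat.mul_le_mul_left _ (by omega))
      · rw [hcoeff i hi, Finset.sum_eq_zero]
        intro b _
        rw [if_neg, mul_zero]
        rintro rfl
        exact hi (dvd_mul_right _ _)
    have hsub : R - Polynomial.C (∑ j ∈ Finset.range (n + 1), R.coeff ((p + 1) * j) * (-c) ^ j) =
        ∑ j ∈ Finset.range (n + 1),
          (Polynomial.C (R.coeff ((p + 1) * j)) * (Polynomial.X ^ (p + 1)) ^ j -
            Polynomial.C (R.coeff ((p + 1) * j) * (-c) ^ j)) := by
      rw [Finset.sum_sub_distrib, ← hRsum, map_sum]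
    rw [hsub]
    refine Finset.dvd_sum fun j _ => ?_
    rw [map_mul, ← mul_sub, map_pow]
    refine Dvd.dvd.mul_left ?_ _
    have := sub_dvd_pow_sub_pow (Polynomial.X ^ (p + 1)) (Polynomial.C (-c)) j
    rwa [map_neg, sub_neg_eq_add, ← map_neg] at this

/-- Bézout's theorem for the Fermat curve. -/
theorem totalMult_fermatForm (hp : ((p + 1 : ℕ) : K) ≠ 0) {n : ℕ} {H : MvPolynomial (Fin 3) K}
    (hH : H.IsHomogeneous n) (hG : ¬ fermatForm K p ∣ H) :
    totalMult (fermatForm K p) H = (n * (p + 1) : ℕ) := by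
  have hpos : 0 < p + 1 := p.succ_pos
  have hprime := prime_fermatForm hp
  obtain ⟨ζ, hζ⟩ := exists_primitiveRoot hp
  obtain ⟨B, hB, hdvd⟩ := exists_binary_norm hp hH
  have hz : ∀ z ∈ Polynomial.nthRootsFinset (p + 1) (1 : K), ¬ fermatForm K p ∣ scaleHom z H := by
    intro z hz h
    rw [Polynomial.mem_nthRootsFinset hpos] at hz
    apply hG
    have := map_dvd (scaleHom (z ^ p)) h
    rwa [scaleHom_scaleHom, ← pow_succ', hz, scaleHom_one, scaleHom_fermatForm] at this
    rw [← pow_mul, mul_comm, pow_mul, hz, one_pow]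
  have hB0 : B ≠ 0 := by
    rintro rfl
    rw [map_zero, sub_zero, hprime.dvd_finsetProd_iff] at hdvd
    obtain ⟨z, hzm, h⟩ := hdvd
    exact hz z hzm h
  -- The norm has p + 1 factors of equal total multiplicity, the binary form has total n(p + 1)²;
  -- cancel p + 1.
  have h := totalMult_congr hdvd
  rw [totalMult_fermatForm_binary hp hB hB0, totalMult_prod hprime _ _ hz,
    Finset.sum_congr rfl fun z hz =>
      totalMult_scaleHom ((Polynomial.mem_nthRootsFinset hpos _).1 hz) H,
    Finset.sum_const, hζ.card_nthRootsFinset, nsmul_eq_mul] at h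
  rw [mul_comm n, mul_assoc, Nat.cast_mul] at h
  rw [mul_comm n, ← mul_comm n]
  exact (ENNReal.mul_right_inj (by exact_mod_cast hpos.ne') (ENNReal.natCast_ne_top _)).1 h

end Bezout
end FermatConics

namespace FermatConics

/-! ### Affine points of the Hermitian curve over a finite field. -/

section Counting

variable {K : Type*} [Field K] {p : ℕ} [Fact p.Prime]

theorem mul_card_fiber_of_surjective {A : Type*} [AddCommGroup A] [Fintype A]
    (μ : A →+ ZMod p) (hμ : Function.Surjective μ) (c : ZMod p) :
    p * Nat.card {x // μ x = c} = Nat.card A := by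
  classical
  have h : ∀ c', Nat.card {x // μ x = c'} = Nat.card {x // μ x = c} := by
    intro c'
    rw [Nat.card_eq_fintype_card, Nat.card_eq_fintype_card, Fintype.card_subtype,
      Fintype.card_subtype]
    exact AddMonoidHom.card_fiber_eq_of_mem_range μ (hμ c') (hμ c)
  rw [← Nat.card_congr (Equiv.sigmaFiberEquiv μ), Nat.card_sigma, Finset.sum_congr rfl fun c' _ => h c',
    Finset.sum_const, Finset.card_univ, ZMod.card, smul_eq_mul]

theorem map_natCast_mul (μ : K →+ ZMod p) (j : ℕ) (x : K) : μ (j * x) = j * μ x := by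
  rw [← nsmul_eq_mul, map_nsmul, nsmul_eq_mul]

/-- The number of `x` with `μ (x ^ (p + 1)) = c`. -/
noncomputable def normFiberCard (μ : K →+ ZMod p) (c : ZMod p) : ℕ :=
  Nat.card {x : K // μ (x ^ (p + 1)) = c}

theorem surjective_of_ne_zero {A : Type*} [AddCommGroup A] (μ : A →+ ZMod p) {a : A}
    (ha : μ a ≠ 0) : Function.Surjective μ := by
  intro c
  refine ⟨(c * (μ a)⁻¹).val • a, ?_⟩
  rw [map_nsmul, nsmul_eq_mul, ZMod.natCast_zmod_val, mul_assoc, inv_mul_cancel₀ ha, mul_one]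

/-- The norm c = u^(p+1) is fixed by the p-th power, so c = (cθ)^p + cθ, which μ kills. -/
theorem map_pow_succ_eq_zero {μ : K →+ ZMod p} (hμ : ∀ w, μ (w ^ p) = -μ w) {θ : K}
    (hθ : θ ^ p + θ = 1) {u : K} (hu : u ^ p ^ 2 = u) : μ (u ^ (p + 1)) = 0 := by
  have h1 : (u ^ (p + 1)) ^ p = u ^ (p + 1) := by
    rw [← pow_mul, add_mul, pow_add, one_mul, ← sq, hu, pow_succ, mul_comm]
  have : u ^ (p + 1) = (u ^ (p + 1) * θ) ^ p + u ^ (p + 1) * θ := by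
    rw [mul_pow, h1, ← mul_add, hθ, mul_one]
  rw [this, map_add, hμ, neg_add_cancel]

theorem add_pow_char_succ [CharP K p] (x u : K) :
    (x + u) ^ (p + 1) = x ^ (p + 1) + x ^ p * u + x * u ^ p + u ^ (p + 1) := by
  rw [pow_succ, add_pow_char]
  ring

/-- Every nonzero element of the prime field is a norm d^(p+1), and x ↦ d x carries one nonzero
fibre to another. -/
theorem normFiberCard_eq [CharP K p] {μ : K →+ ZMod p}
    (hd : ∀ j : ℕ, (j : K) ≠ 0 → ∃ d : K, d ^ (p + 1) = j) {c : ZMod p} (hc : c ≠ 0) :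
    normFiberCard μ c = normFiberCard μ 1 := by
  have hc' : (c.val : K) ≠ 0 := by
    rw [Ne, CharP.cast_eq_zero_iff K p, ← ZMod.natCast_eq_zero_iff, ZMod.natCast_zmod_val]
    exact hc
  obtain ⟨d, hd⟩ := hd _ hc'
  have hd0 : d ≠ 0 := by
    rintro rfl
    rw [zero_pow p.succ_ne_zero] at hd
    exact hc' hd.symm
  symm
  refine Nat.card_congr ((Equiv.mulLeft₀ d hd0).subtypeEquiv fun x => ?_)
  change _ ↔ μ ((d * x) ^ (p + 1)) = c
  rw [mul_pow, hd, map_natCast_mul, ZMod.natCast_zmod_val]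
  constructor
  · intro h; rw [h, mul_one]
  · intro h; exact mul_left_cancel₀ hc (h.trans (mul_one c).symm)

variable [Fintype K]

theorem sum_normFiberCard (μ : K →+ ZMod p) : ∑ c, normFiberCard μ c = Nat.card K := by
  rw [← Nat.card_congr (Equiv.sigmaFiberEquiv fun x : K => μ (x ^ (p + 1))), Nat.card_sigma]
  rfl

/-- The (p + 1)-th roots of unity act freely on this fibre. -/
theorem dvd_normFiberCard_one (μ : K →+ ZMod p)
    (hroots : Nat.card {d : K // d ^ (p + 1) = 1} = p + 1) : p + 1 ∣ normFiberCard μ 1 := by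
  classical
  rw [normFiberCard, Nat.card_eq_fintype_card, Fintype.card_subtype,
    Finset.card_eq_sum_card_image fun x => x ^ (p + 1)]
  refine Finset.dvd_sum fun b hb => ?_
  obtain ⟨x, hx, rfl⟩ := Finset.mem_image.1 hb
  rw [Finset.mem_filter_univ] at hx
  have hx0 : x ≠ 0 := by
    rintro rfl
    rw [zero_pow p.succ_ne_zero, map_zero] at hx
    exact zero_ne_one hx
  refine dvd_of_eq ?_
  rw [Nat.card_eq_fintype_card, Fintype.card_subtype] at hroots
  refine hroots.symm.trans (Finset.card_bij (fun d _ => d * x) ?_ ?_ ?_)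
  · intro d hd
    simp only [Finset.mem_univ, true_and, Finset.mem_filter] at hd ⊢
    rw [mul_pow, hd, one_mul]
    exact ⟨hx, rfl⟩
  · intro a _ b _ h
    exact mul_right_cancel₀ hx0 h
  · intro y hy
    simp only [Finset.mem_univ, true_and, Finset.mem_filter] at hy
    refine ⟨y / x, ?_, div_mul_cancel₀ _ hx0⟩
    rw [Finset.mem_filter_univ, div_pow, hy.2, div_self (pow_ne_zero _ hx0)]

variable [CharP K p]

/-- The second moment of the fibres of `x ↦ μ (x ^ (p + 1))`. -/
theorem sum_normFiberCard_sq {μ : K →+ ZMod p} (hμ : ∀ w, μ (w ^ p) = -μ w)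
    (hμ0 : ∃ a, μ a ≠ 0) {θ : K} (hθ : θ ^ p + θ = 1) :
    (p : ℤ) * ∑ c, (normFiberCard μ c : ℤ) ^ 2 =
      p * Nat.card K * Nat.card {u : K // u ^ p ^ 2 = u} +
        (Nat.card K - Nat.card {u : K // u ^ p ^ 2 = u}) * Nat.card K := by
  classical
  set f : K → ZMod p := fun x => μ (x ^ (p + 1)) with hf
  -- Pairs in a common fibre are sorted by their difference u.
  have h1 : ∑ c, (normFiberCard μ c : ℤ) ^ 2 = ∑ u : K, (Nat.card {x // f (x + u) = f x} : ℤ) := by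
    have e : (Σ c : ZMod p, {x // f x = c} × {x // f x = c}) ≃ Σ u : K, {x // f (x + u) = f x} :=
      { toFun := fun s => ⟨s.2.2 - s.2.1, s.2.1, by
          rw [add_sub_cancel, s.2.1.2, s.2.2.2]⟩
        invFun := fun s => ⟨f s.2, ⟨s.2, rfl⟩, ⟨s.2 + s.1, s.2.2⟩⟩
        left_inv := by
          rintro ⟨c, ⟨x, rfl⟩, ⟨y, hy⟩⟩
          simp
        right_inv := by
          rintro ⟨u, x, hx⟩
          have : x + u - x = u := by ring
          ext <;> simp [this] }
    have := Nat.card_congr e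
    rw [Nat.card_sigma, Nat.card_sigma] at this
    rw [← Nat.cast_sum, ← this]
    push_cast
    refine Finset.sum_congr rfl fun c _ => ?_
    rw [Nat.card_prod, sq]
    push_cast
    rfl
  have h2 : ∀ u : K, (p : ℤ) * Nat.card {x // f (x + u) = f x} =
      if u ^ p ^ 2 = u then (p : ℤ) * Nat.card K else Nat.card K := by
    intro u
    obtain ⟨r, hr⟩ := surjective_frobenius K p u
    rw [frobenius_def] at hr
    -- With r^p = u, the cross term μ(x^p u) is -μ(x r), so the condition is affine in x. Its linear
    -- part vanishes exactly when u^(p²) = u, the radical of the form.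
    have key : ∀ x, f (x + u) = f x ↔ μ (x * (u ^ p - r)) = - μ (u ^ (p + 1)) := by
      intro x
      have : μ (x ^ p * u) = - μ (x * r) := by rw [← hμ, mul_pow, hr]
      simp only [hf]
      rw [add_pow_char_succ, map_add, map_add, map_add, this, mul_sub, map_sub]
      constructor <;> intro h <;> linear_combination h
    simp only [key]
    split_ifs with hu
    · have hr' : u ^ p = r := by
        apply frobenius_inj K p
        rw [frobenius_def, frobenius_def, hr, ← pow_mul, ← sq, hu]
      rw [hr', map_pow_succ_eq_zero hμ hθ hu]
      simp
    · have hr' : u ^ p - r ≠ 0 := by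
        intro h
        apply hu
        rw [sq, pow_mul, sub_eq_zero.1 h, hr]
      obtain ⟨a, ha⟩ := hμ0
      have := mul_card_fiber_of_surjective (μ.comp (AddMonoidHom.mulRight (u ^ p - r)))
        (surjective_of_ne_zero _ (a := a / (u ^ p - r)) (by simpa [hr'] using ha))
        (- μ (u ^ (p + 1)))
      exact_mod_cast this
  rw [h1, Finset.mul_sum, Finset.sum_congr rfl fun u _ => h2 u, Finset.sum_ite, Finset.sum_const,
    Finset.sum_const]
  have h3 : (Finset.univ.filter fun u : K => u ^ p ^ 2 = u).card =
      Nat.card {u : K // u ^ p ^ 2 = u} := by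
    rw [Nat.card_eq_fintype_card, Fintype.card_subtype]
  have h4 := Finset.card_filter_add_card_filter_not (s := Finset.univ) fun u : K => u ^ p ^ 2 = u
  rw [h3, Finset.card_univ, ← Nat.card_eq_fintype_card] at h4
  rw [h3, nsmul_eq_mul, nsmul_eq_mul]
  have hfour : (Nat.card {u : K // u ^ p ^ 2 = u} : ℤ) +
      (Finset.univ.filter fun u : K => ¬ u ^ p ^ 2 = u).card = Nat.card K := by exact_mod_cast h4
  linear_combination (Nat.card K : ℤ) * hfour

/-- The number of zeros of the form `x ↦ μ (x ^ (p + 1))`. -/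
theorem mul_normFiberCard_zero {n : ℕ} (hK : Nat.card K = p ^ (2 * n)) {μ : K →+ ZMod p}
    (hμ : ∀ w, μ (w ^ p) = -μ w) (hμ0 : ∃ a, μ a ≠ 0) {θ : K} (hθ : θ ^ p + θ = 1)
    (hd : ∀ j : ℕ, (j : K) ≠ 0 → ∃ d : K, d ^ (p + 1) = j)
    (hroots : Nat.card {d : K // d ^ (p + 1) = 1} = p + 1)
    (hfix : Nat.card {u : K // u ^ p ^ 2 = u} = p ^ 2) :
    (p : ℤ) * normFiberCard μ 0 = p ^ (2 * n) + (p - 1) * (-p) ^ (n + 1) := by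
  classical
  have hp : 2 ≤ p := (Fact.out : p.Prime).two_le
  set N0 : ℤ := (normFiberCard μ 0 : ℤ)
  set N1 : ℤ := (normFiberCard μ 1 : ℤ)
  have hsum : ∀ F : ℕ → ℤ, ∑ c : ZMod p, F (normFiberCard μ c) =
      F (normFiberCard μ 0) + (p - 1) * F (normFiberCard μ 1) := by
    intro F
    rw [← Finset.add_sum_erase _ _ (Finset.mem_univ (0 : ZMod p)), Finset.sum_congr rfl
      (g := fun _ => F (normFiberCard μ 1)), Finset.sum_const, Finset.card_erase_of_mem
      (Finset.mem_univ _), Finset.card_univ, ZMod.card, nsmul_eq_mul]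
    · push_cast [show 1 ≤ p by omega]; ring
    · intro c hc
      rw [normFiberCard_eq hd (Finset.ne_of_mem_erase hc)]
  have e1 : N0 + (p - 1) * N1 = p ^ (2 * n) := by
    have := hsum fun x => x
    rw [← this]
    exact_mod_cast (sum_normFiberCard μ).trans hK
  have e2 := sum_normFiberCard_sq hμ hμ0 hθ
  rw [hsum fun x => (x : ℤ) ^ 2, hK, hfix] at e2
  push_cast at e2
  -- The first two moments determine N0 - N1 up to sign.
  have hsq : (N0 - N1) ^ 2 = ((-p) ^ (n + 1) : ℤ) ^ 2 := by
    have hp1 : ((p : ℤ) - 1) ≠ 0 := by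
      have : (2 : ℤ) ≤ p := by exact_mod_cast hp
      omega
    apply mul_left_cancel₀ hp1
    have e3 : ((-p : ℤ) ^ (n + 1)) ^ 2 = p ^ (2 * n) * p ^ 2 := by
      rw [← pow_mul, mul_comm, pow_mul, neg_sq, ← pow_mul, mul_add, pow_add, mul_one]
    rw [e3]
    linear_combination e2 - (N0 + (p - 1) * N1 + p ^ (2 * n)) * e1
  rcases sq_eq_sq_iff_eq_or_eq_neg.1 hsq with h | h
  · linear_combination (p - 1) * h + e1
  -- The other sign would give p N1 = p^(2n) + (-p)^(n+1). Modulo p + 1 the left side is 0 and the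
  -- right side is 2, which is impossible as p + 1 ≥ 3.
  · exfalso
    obtain ⟨a, ha⟩ : ((p : ℤ) + 1) ∣ N1 := by
      have := Int.natCast_dvd_natCast.2 (dvd_normFiberCard_one μ hroots)
      rwa [Nat.cast_add, Nat.cast_one] at this
    have d1 : ((p : ℤ) + 1) ∣ p ^ (2 * n) - 1 := by
      have := sub_dvd_pow_sub_pow ((p : ℤ) ^ 2) 1 n
      rw [one_pow, ← pow_mul] at this
      exact (Dvd.intro (p - 1 : ℤ) (by ring)).trans this
    have d2 : ((p : ℤ) + 1) ∣ (-p) ^ (n + 1) - 1 := by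
      have := sub_dvd_pow_sub_pow (-p : ℤ) 1 (n + 1)
      rw [one_pow] at this
      exact (Dvd.intro (-1 : ℤ) (by ring)).trans this
    obtain ⟨b, hb⟩ := d1
    obtain ⟨c, hc⟩ := d2
    have : ((p : ℤ) + 1) ∣ 2 := ⟨p * a - b - c, by linear_combination p * ha - hb - hc - e1 + h⟩
    have := Int.le_of_dvd (by norm_num) this
    have : (2 : ℤ) ≤ p := by exact_mod_cast hp
    omega

/-- The additive functional on `K` whose kernel is the image of `w ↦ w ^ p + w`. -/
theorem exists_functional (hker : Nat.card {w : K // w ^ p + w = 0} = p) :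
    ∃ μ : K →+ ZMod p, (∀ x, μ x = 0 ↔ ∃ w, w ^ p + w = x) ∧ ∃ a, μ a ≠ 0 := by
  let L : K →+ K := (frobenius K p).toAddMonoidHom + AddMonoidHom.id K
  have hL : ∀ w, L w = w ^ p + w := fun w => rfl
  -- The cokernel of an endomorphism of a finite group has the order of its kernel.
  have hcard : Nat.card (K ⧸ L.range) = p := by
    have h1 := L.range.card_eq_card_quotient_mul_card_addSubgroup
    have h2 := L.ker.card_eq_card_quotient_mul_card_addSubgroup
    rw [Nat.card_congr (QuotientAddGroup.quotientKerEquivRange L).toEquiv] at h2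
    have h3 : Nat.card L.ker = p := by
      rw [← hker]
      exact Nat.card_congr (Equiv.subtypeEquivRight fun w => by rw [AddMonoidHom.mem_ker, hL])
    rw [h3, mul_comm] at h2
    have h4 : 0 < Nat.card L.range := Nat.card_pos
    exact Nat.eq_of_mul_eq_mul_right h4 (h1.symm.trans h2)
  have hcyc : IsAddCyclic (K ⧸ L.range) := isAddCyclic_of_prime_card hcard
  obtain ⟨e⟩ : Nonempty (ZMod p ≃+ (K ⧸ L.range)) := by
    have e := zmodAddCyclicAddEquiv hcyc
    rw [hcard] at e
    exact ⟨e⟩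
  refine ⟨e.symm.toAddMonoidHom.comp (QuotientAddGroup.mk' L.range), ?_, ?_⟩
  · intro x
    change e.symm (QuotientAddGroup.mk' L.range x) = 0 ↔ _
    rw [map_eq_zero_iff _ e.symm.injective, QuotientAddGroup.mk'_apply,
      QuotientAddGroup.eq_zero_iff]
    rfl
  · obtain ⟨a, ha⟩ := QuotientAddGroup.mk'_surjective L.range (e 1)
    refine ⟨a, ?_⟩
    change e.symm (QuotientAddGroup.mk' L.range a) ≠ 0
    rw [ha, AddEquiv.symm_apply_apply]
    exact one_ne_zero

/-- The number of affine points of `w ^ p + w + x ^ (p + 1) = 0`. -/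
theorem card_hermitian_affine {n : ℕ} (hK : Nat.card K = p ^ (2 * n))
    (hker : Nat.card {w : K // w ^ p + w = 0} = p) {θ : K} (hθ : θ ^ p + θ = 1)
    (hd : ∀ j : ℕ, (j : K) ≠ 0 → ∃ d : K, d ^ (p + 1) = j)
    (hroots : Nat.card {d : K // d ^ (p + 1) = 1} = p + 1)
    (hfix : Nat.card {u : K // u ^ p ^ 2 = u} = p ^ 2) :
    (Nat.card {z : K × K // z.2 ^ p + z.2 + z.1 ^ (p + 1) = 0} : ℤ) =
      p ^ (2 * n) + (p - 1) * (-p) ^ (n + 1) := by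
  classical
  obtain ⟨μ, hμ, hμ0⟩ := exists_functional (K := K) hker
  have hμ' : ∀ w, μ (w ^ p) = -μ w := by
    intro w
    rw [eq_neg_iff_add_eq_zero, ← map_add, hμ]
    exact ⟨w, rfl⟩
  rw [← mul_normFiberCard_zero hK hμ' hμ0 hθ hd hroots hfix]
  -- The fibre over x is empty or a translate of the kernel of w ↦ w^p + w.
  have hfib : ∀ x : K, Nat.card {w : K // w ^ p + w + x ^ (p + 1) = 0} =
      if μ (x ^ (p + 1)) = 0 then p else 0 := by
    intro x
    split_ifs with h
    · obtain ⟨w₀, hw₀⟩ := (hμ _).1 h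
      conv_rhs => rw [← hker]
      refine Nat.card_congr ((Equiv.addRight w₀).subtypeEquiv fun w => ?_)
      rw [Equiv.coe_addRight, add_pow_char, ← hw₀]
      constructor <;> intro h <;> linear_combination h
    · have : IsEmpty {w : K // w ^ p + w + x ^ (p + 1) = 0} := by
        refine ⟨fun w => h ?_⟩
        rw [← neg_eq_zero, ← map_neg, hμ]
        exact ⟨w, by linear_combination w.2⟩
      exact Nat.card_of_isEmpty
  have e : {z : K × K // z.2 ^ p + z.2 + z.1 ^ (p + 1) = 0} ≃
      Σ x : K, {w : K // w ^ p + w + x ^ (p + 1) = 0} :=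
    { toFun := fun z => ⟨z.1.1, z.1.2, z.2⟩
      invFun := fun s => ⟨(s.1, s.2), s.2.2⟩
      left_inv := fun _ => rfl
      right_inv := fun _ => rfl }
  rw [Nat.card_congr e, Nat.card_sigma, Finset.sum_congr rfl fun x _ => hfib x, Finset.sum_ite,
    Finset.sum_const, Finset.sum_const_zero, add_zero, normFiberCard, Nat.card_eq_fintype_card,
    Fintype.card_subtype, smul_eq_mul]
  push_cast
  ring

end Counting

end FermatConics

namespace FermatConics

/-! ### Rational points of the Fermat curve. -/

section RationalPoints

variable {k : Type*} [Field k]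

theorem mk_mem_fermatCurve_iff {p : ℕ} (v : Fin 3 → k) (hv : v ≠ 0) :
    Projectivization.mk k v hv ∈ fermatCurve k p ↔
      v 0 ^ (p + 1) + v 1 ^ (p + 1) + v 2 ^ (p + 1) = 0 := by
  rw [fermatCurve, mk_mem_zeroLocus_iff (isHomogeneous_fermatForm k p)]
  simp [fermatForm, Fin.sum_univ_three]

/-- The coordinatewise `q`-th power of `v` is proportional to `v`. -/
def FrobFixed (q : ℕ) (v : Fin 3 → k) : Prop :=
  ∀ i j, v i ^ q * v j = v j ^ q * v i

theorem FrobFixed.smul {q : ℕ} {v : Fin 3 → k} (h : FrobFixed q v) (a : k) :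
    FrobFixed q (a • v) := by
  intro i j
  simp only [Pi.smul_apply, smul_eq_mul, mul_pow]
  linear_combination (a ^ q * a) * h i j

theorem frobFixed_mk_rep_iff {q : ℕ} (v : Fin 3 → k) (hv : v ≠ 0) :
    FrobFixed q (Projectivization.mk k v hv).rep ↔ FrobFixed q v := by
  obtain ⟨a, ha⟩ := Projectivization.exists_smul_eq_mk_rep k v hv
  rw [← ha]
  refine ⟨fun h => ?_, fun h => h.smul (a : k)⟩
  simpa [Units.smul_def] using h.smul ((a⁻¹ : kˣ) : k)

theorem FrobFixed.exists_smul {q : ℕ} {v : Fin 3 → k} (h : FrobFixed q v) (hv : v ≠ 0) :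
    ∃ a : k, a ≠ 0 ∧ ∀ i, (a • v) i ^ q = (a • v) i := by
  obtain ⟨i, hi⟩ := Function.ne_iff.1 hv
  rw [Pi.zero_apply] at hi
  refine ⟨(v i)⁻¹, inv_ne_zero hi, fun j => ?_⟩
  rw [Pi.smul_apply, smul_eq_mul, mul_pow, inv_pow]
  field_simp
  exact h j i

theorem frobFixed_of_pow_eq {q : ℕ} {v : Fin 3 → k} (h : ∀ i, v i ^ q = v i) : FrobFixed q v := by
  intro i j
  rw [h, h, mul_comm]

/-- The points of the Fermat curve that are rational over the field with `q` elements. -/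
def rationalPoints (k : Type*) [Field k] (p q : ℕ) : Set (Plane k) :=
  {t ∈ fermatCurve k p | FrobFixed q t.rep}

theorem pow_sq_eq_of_pow_succ {p : ℕ} {x c : k} (h : x ^ (p + 1) = c) (hc : c ^ p = c) (hc0 : c ≠ 0) :
    x ^ p ^ 2 = x := by
  have hx : x ≠ 0 := by
    rintro rfl
    rw [zero_pow p.succ_ne_zero] at h
    exact hc0 h.symm
  have h1 : x ^ p ^ 2 * x ^ p = x * x ^ p := by
    rw [← pow_add, sq, show p * p + p = (p + 1) * p by ring, pow_mul, h, hc, ← h, pow_succ']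
  exact mul_right_cancel₀ (pow_ne_zero p hx) h1

theorem cast_succ_ne_zero {p : ℕ} [CharP k p] : ((p + 1 : ℕ) : k) ≠ 0 := by
  simp

theorem card_roots_eq_natDegree [IsAlgClosed k] {f : Polynomial k} (hf : f.Separable) :
    Nat.card {x : k // f.eval x = 0} = f.natDegree := by
  classical
  rw [← Polynomial.card_rootSet_eq_natDegree (K := k) hf (IsAlgClosed.splits _),
    ← Nat.card_eq_fintype_card]
  refine Nat.card_congr (Equiv.subtypeEquivRight fun x => ?_)
  rw [Polynomial.mem_rootSet_of_ne hf.ne_zero, Polynomial.coe_aeval_eq_eval]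

variable {p : ℕ} [Fact p.Prime] [CharP k p]

/-- The subfield of `k` with `p ^ N` elements. -/
def frobSubfield (k : Type*) [Field k] (p N : ℕ) [Fact p.Prime] [CharP k p] : Subfield k :=
  (iterateFrobenius k p N).eqLocusField (RingHom.id k)

theorem mem_frobSubfield_iff {N : ℕ} {x : k} : x ∈ frobSubfield k p N ↔ x ^ p ^ N = x := Iff.rfl

theorem mem_frobSubfield_of_pow_sq {n : ℕ} {x : k} (hx : x ^ p ^ 2 = x) :
    x ∈ frobSubfield k p (2 * n) := by
  rw [mem_frobSubfield_iff, pow_mul]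
  induction n with
  | zero => simp
  | succ n ih => rw [pow_succ, pow_mul, ih, hx]

variable [IsAlgClosed k]

theorem card_pow_eq_self {N : ℕ} (hN : N ≠ 0) : Nat.card {x : k // x ^ p ^ N = x} = p ^ N := by
  have hsep : (Polynomial.X ^ p ^ N - Polynomial.X : Polynomial k).Separable :=
    galois_poly_separable p _ (dvd_pow_self p hN)
  have hdeg : (Polynomial.X ^ p ^ N - Polynomial.X : Polynomial k).natDegree = p ^ N :=
    FiniteField.X_pow_card_pow_sub_X_natDegree_eq k hN (Fact.out : p.Prime).one_lt
  conv_rhs => rw [← hdeg, ← card_roots_eq_natDegree hsep]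
  exact Nat.card_congr (Equiv.subtypeEquivRight fun x => by simp [sub_eq_zero])

theorem card_frobSubfield {N : ℕ} (hN : N ≠ 0) : Nat.card (frobSubfield k p N) = p ^ N :=
  card_pow_eq_self (k := k) hN

theorem card_affine_points {n : ℕ} (hn : n ≠ 0) :
    (Nat.card {z : frobSubfield k p (2 * n) × frobSubfield k p (2 * n) //
      z.2 ^ p + z.2 + z.1 ^ (p + 1) = 0} : ℤ) = p ^ (2 * n) + (p - 1) * (-p) ^ (n + 1) := by
  have hp := (Fact.out : p.Prime)
  have hcard : Nat.card (frobSubfield k p (2 * n)) = p ^ (2 * n) :=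
    card_frobSubfield (by omega)
  have hfin : Finite (frobSubfield k p (2 * n)) :=
    Nat.finite_of_card_ne_zero (by rw [hcard]; exact pow_ne_zero _ hp.ne_zero)
  have := Fintype.ofFinite (frobSubfield k p (2 * n))
  -- All auxiliary elements satisfy x^(p²) = x and so lie in the subfield; they can be counted in k
  -- as roots of separable polynomials.
  have hres : ∀ (P : k → Prop), (∀ x, P x → x ^ p ^ 2 = x) →
      Nat.card {x : frobSubfield k p (2 * n) // P x} = Nat.card {x : k // P x} := by
    intro P hP
    refine Nat.card_congr
      { toFun := fun x => ⟨x.1, x.2⟩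
        invFun := fun x => ⟨⟨x.1, mem_frobSubfield_of_pow_sq (hP _ x.2)⟩, x.2⟩
        left_inv := fun _ => rfl
        right_inv := fun _ => rfl }
  have hneg : ((-1 : k)) ^ p = -1 := by
    rw [neg_one_pow_char]
  obtain ⟨θ, hθ⟩ : ∃ θ : k, θ ^ p + θ = 1 := by
    obtain ⟨θ, hθ⟩ := IsAlgClosed.exists_root (Polynomial.X ^ p + (Polynomial.X - 1) : Polynomial k)
      (by
        rw [Polynomial.degree_add_eq_left_of_degree_lt]
        · simpa using hp.ne_zero
        · rw [Polynomial.degree_X_pow, ← Polynomial.C_1, Polynomial.degree_X_sub_C]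
          exact_mod_cast hp.one_lt)
    refine ⟨θ, ?_⟩
    simp at hθ
    linear_combination hθ
  have hθ2 : θ ^ p ^ 2 = θ := by
    have h1 : θ ^ p = 1 - θ := by linear_combination hθ
    rw [sq, pow_mul, h1, sub_pow_char, one_pow, h1]
    ring
  refine card_hermitian_affine hcard ?_ (θ := ⟨θ, mem_frobSubfield_of_pow_sq hθ2⟩) ?_ ?_ ?_ ?_
  · have h1 := hres (fun x => x ^ p + x = 0) fun x hx => by
      have h1 : x ^ p = -x := by linear_combination hx
      rw [sq, pow_mul, h1, neg_pow, h1, hneg]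
      ring
    have hsep : (Polynomial.X ^ p + Polynomial.X : Polynomial k).Separable := by
      rw [Polynomial.separable_def, Polynomial.derivative_add, Polynomial.derivative_X_pow,
        Polynomial.derivative_X, CharP.cast_eq_zero, Polynomial.C_0, zero_mul, zero_add]
      exact isCoprime_one_right
    have hdeg : (Polynomial.X ^ p + Polynomial.X : Polynomial k).natDegree = p := by
      rw [Polynomial.natDegree_add_eq_left_of_natDegree_lt]
      · simp
      · simpa using hp.one_lt
    have h2 := card_roots_eq_natDegree hsep
    rw [hdeg] at h2
    simp only [Polynomial.eval_add, Polynomial.eval_pow, Polynomial.eval_X] at h2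
    rw [← h1] at h2
    convert h2 using 4
    rw [← Subtype.coe_inj]
    simp
  · rw [← Subtype.coe_inj]
    simpa using hθ
  · intro j hj
    obtain ⟨d, hd⟩ := IsAlgClosed.exists_pow_nat_eq (j : k) p.succ_pos
    refine ⟨⟨d, mem_frobSubfield_of_pow_sq (pow_sq_eq_of_pow_succ hd ?_ ?_)⟩, ?_⟩
    · rw [← frobenius_def, map_natCast]
    · intro h
      apply hj
      rw [← Subtype.coe_inj]
      simpa using h
    · rw [← Subtype.coe_inj]
      simpa using hd
  · have h1 := hres (fun x => x ^ (p + 1) = 1) fun x hx =>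
      pow_sq_eq_of_pow_succ hx (one_pow _) one_ne_zero
    have hsep : (Polynomial.X ^ (p + 1) - Polynomial.C 1 : Polynomial k).Separable :=
      Polynomial.separable_X_pow_sub_C 1 cast_succ_ne_zero one_ne_zero
    have h2 := card_roots_eq_natDegree hsep
    rw [Polynomial.natDegree_X_pow_sub_C] at h2
    simp only [Polynomial.eval_sub, Polynomial.eval_pow, Polynomial.eval_X, Polynomial.eval_C,
      sub_eq_zero] at h2
    rw [← h1] at h2
    convert h2 using 4
    rw [← Subtype.coe_inj]
    simp
  · have h1 := hres (fun x => x ^ p ^ 2 = x) fun x hx => hx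
    rw [card_pow_eq_self two_ne_zero] at h1
    convert h1 using 4
    rw [← Subtype.coe_inj]
    simp

/-- The number of points of the Fermat curve over the field with `p ^ (2 * n)` elements. -/
theorem ncard_rationalPoints {n : ℕ} (hn : n ≠ 0) :
    ((rationalPoints k p (p ^ (2 * n))).ncard : ℤ) =
      p ^ (2 * n) + 1 + (p - 1) * (-p) ^ (n + 1) := by
  have hp := (Fact.out : p.Prime)
  have hneg : ((-1 : k)) ^ p = -1 := neg_one_pow_char k p
  -- (1, α) and (1, β) are isotropic for the Hermitian form in the last two coordinates; in the
  -- basis they form only the mixed terms of `hnorm` survive, with coefficients c and c^p.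
  obtain ⟨α, β, hα, hβ, hαβ⟩ : ∃ α β : k, α ^ (p + 1) = -1 ∧ β ^ (p + 1) = -1 ∧ α ≠ β := by
    have h2 := card_roots_eq_natDegree (Polynomial.separable_X_pow_sub_C (-1 : k)
      (cast_succ_ne_zero (p := p)) (neg_ne_zero.2 one_ne_zero))
    rw [Polynomial.natDegree_X_pow_sub_C] at h2
    have := Nat.finite_of_card_ne_zero (by rw [h2]; exact p.succ_ne_zero)
    have h3 := Finite.one_lt_card_iff_nontrivial.1 (by rw [h2]; exact Nat.lt_add_of_pos_left hp.pos)
    obtain ⟨a, b, hab⟩ := h3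
    refine ⟨a, b, ?_, ?_, fun h => hab (Subtype.ext h)⟩
    · simpa [sub_eq_zero, add_eq_zero_iff_eq_neg] using a.2
    · simpa [sub_eq_zero, add_eq_zero_iff_eq_neg] using b.2
  have hα2 := pow_sq_eq_of_pow_succ hα hneg (neg_ne_zero.2 one_ne_zero)
  have hβ2 := pow_sq_eq_of_pow_succ hβ hneg (neg_ne_zero.2 one_ne_zero)
  have hαE : α ∈ frobSubfield k p (2 * n) := mem_frobSubfield_of_pow_sq hα2
  have hβE : β ∈ frobSubfield k p (2 * n) := mem_frobSubfield_of_pow_sq hβ2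
  have hsub : α - β ≠ 0 := sub_ne_zero.2 hαβ
  set c : k := 1 + α ^ p * β with hc
  have hcE : c ∈ frobSubfield k p (2 * n) :=
    add_mem (one_mem _) (mul_mem (pow_mem hαE _) hβE)
  have hc0 : c ≠ 0 := by
    intro h
    apply hαβ
    have hα0 : α ≠ 0 := by
      rintro rfl
      rw [zero_pow p.succ_ne_zero] at hα
      simp at hα
    apply mul_left_cancel₀ (pow_ne_zero p hα0)
    linear_combination hα - h + hc
  have hcp : c ^ p = 1 + α * β ^ p := by
    rw [hc, add_pow_char, one_pow, mul_pow, ← pow_mul, ← sq, hα2]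
  have hnorm : ∀ U W : k, (U + W) ^ (p + 1) + (α * U + β * W) ^ (p + 1) =
      U ^ p * W * c + U * W ^ p * c ^ p := by
    intro U W
    rw [hcp, hc, pow_succ, pow_succ (α * U + β * W), add_pow_char, add_pow_char, mul_pow, mul_pow]
    rw [pow_succ] at hα hβ
    linear_combination (U ^ p * U) * hα + (W ^ p * W) * hβ
  let E := frobSubfield k p (2 * n)
  let T := {z : E × E // z.2 ^ p + z.2 + z.1 ^ (p + 1) = 0}
  -- Setting U = 1 and W = w / c gives the affine equation; `none` is the single point with U = 0.
  let vec : Option T → Fin 3 → k := fun z => z.elim ![0, 1, β] fun z =>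
    ![z.1.1, 1 + z.1.2 / c, α + β * (z.1.2 / c)]
  have hvec0 : ∀ z, vec z ≠ 0 := by
    rintro (_ | z) h
    · simpa [vec] using congrFun h 1
    · have h1 : 1 + (z.1.2 : k) / c = 0 := congrFun h 1
      have h2 : α + β * ((z.1.2 : k) / c) = 0 := congrFun h 2
      exact hsub (by linear_combination h2 - β * h1)
  let g : Option T → Plane k := fun z => Projectivization.mk k (vec z) (hvec0 z)
  have hginj : Function.Injective g := by
    rintro (_ | z) (_ | z') h
    · rfl
    · obtain ⟨a, ha⟩ := (Projectivization.mk_eq_mk_iff' k _ _ _ _).1 h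
      exfalso
      have h1 : a * (1 + (z'.1.2 : k) / c) = 1 := congrFun ha 1
      have h2 : a * (α + β * ((z'.1.2 : k) / c)) = β := congrFun ha 2
      have h3 : a * (α - β) = 0 := by linear_combination h2 - β * h1
      rcases mul_eq_zero.1 h3 with h4 | h4
      · rw [h4, zero_mul] at h1
        exact zero_ne_one h1
      · exact hsub h4
    · obtain ⟨a, ha⟩ := (Projectivization.mk_eq_mk_iff' k _ _ _ _).1 h
      exfalso
      have h1 : a * 1 = 1 + (z.1.2 : k) / c := congrFun ha 1
      have h2 : a * β = α + β * ((z.1.2 : k) / c) := congrFun ha 2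
      exact hsub (by linear_combination β * h1 - h2)
    · obtain ⟨a, ha⟩ := (Projectivization.mk_eq_mk_iff' k _ _ _ _).1 h
      have h0 : a * (z'.1.1 : k) = z.1.1 := congrFun ha 0
      have h1 : a * (1 + (z'.1.2 : k) / c) = 1 + (z.1.2 : k) / c := congrFun ha 1
      have h2 : a * (α + β * ((z'.1.2 : k) / c)) = α + β * ((z.1.2 : k) / c) := congrFun ha 2
      have h3 : a = 1 := by
        apply mul_right_cancel₀ hsub
        linear_combination h2 - β * h1
      rw [h3, one_mul] at h0 h1
      have h4 : (z'.1.2 : k) = z.1.2 := by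
        have : (z'.1.2 : k) / c = z.1.2 / c := add_left_cancel h1
        rwa [div_left_inj' hc0] at this
      congr 1
      exact Subtype.ext (Prod.ext (Subtype.ext h0.symm) (Subtype.ext h4.symm))
  have hrange : Set.range g = rationalPoints k p (p ^ (2 * n)) := by
    apply Set.Subset.antisymm
    · rintro _ ⟨z, rfl⟩
      refine ⟨(mk_mem_fermatCurve_iff _ _).2 ?_, (frobFixed_mk_rep_iff _ _).2
        (frobFixed_of_pow_eq ?_)⟩
      · rcases z with _ | z
        · simp [vec, hβ]
        · change (z.1.1 : k) ^ (p + 1) + (1 + (z.1.2 : k) / c) ^ (p + 1) +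
            (α + β * ((z.1.2 : k) / c)) ^ (p + 1) = 0
          have h1 := hnorm 1 ((z.1.2 : k) / c)
          have h2 : (z.1.2 : k) ^ p + z.1.2 + z.1.1 ^ (p + 1) = 0 := by
            have := congrArg (Subtype.val) z.2
            simpa using this
          rw [mul_one, div_pow, one_pow] at h1
          rw [add_assoc, h1]
          field_simp
          linear_combination h2
      · intro i
        change vec z i ∈ E
        rcases z with _ | z
        · fin_cases i
          exacts [zero_mem _, one_mem _, hβE]
        · have hw : (z.1.2 : k) / c ∈ E := div_mem z.1.2.2 hcE
          fin_cases i
          exacts [z.1.1.2, add_mem (one_mem _) hw, add_mem hαE (mul_mem hβE hw)]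
    · rintro t ⟨htC, htF⟩
      obtain ⟨a, ha0, ha⟩ := htF.exists_smul t.rep_nonzero
      set v := a • t.rep with hv
      have hv0 : v ≠ 0 := smul_ne_zero ha0 t.rep_nonzero
      have ht : t = Projectivization.mk k v hv0 := by
        conv_lhs => rw [← t.mk_rep]
        rw [Projectivization.mk_eq_mk_iff']
        exact ⟨a⁻¹, by rw [hv, smul_smul, inv_mul_cancel₀ ha0, one_smul]⟩
      have hvE : ∀ i, v i ∈ E := ha
      rw [ht, mk_mem_fermatCurve_iff] at htC
      set U := (v 2 - β * v 1) / (α - β) with hU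
      set W := (α * v 1 - v 2) / (α - β) with hW
      have hUE : U ∈ E := div_mem (sub_mem (hvE 2) (mul_mem hβE (hvE 1))) (sub_mem hαE hβE)
      have hWE : W ∈ E := div_mem (sub_mem (mul_mem hαE (hvE 1)) (hvE 2)) (sub_mem hαE hβE)
      have h1 : v 1 = U + W := by rw [hU, hW]; field_simp; ring
      have h2 : v 2 = α * U + β * W := by rw [hU, hW]; field_simp; ring
      rw [add_assoc, h1, h2, hnorm] at htC
      clear_value U W
      by_cases hU0 : U = 0
      · refine ⟨none, ?_⟩
        rw [hU0, zero_pow hp.ne_zero] at htC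
        have h0 : v 0 = 0 := by
          apply eq_zero_of_pow_eq_zero (n := p + 1)
          linear_combination htC
        rw [ht]
        have hW0 : W ≠ 0 := by
          intro hW0
          apply hv0
          ext i
          fin_cases i
          · exact h0
          · simpa [hU0, hW0] using h1
          · simpa [hU0, hW0] using h2
        refine (Projectivization.mk_eq_mk_iff' k _ _ _ _).2 ⟨W⁻¹, ?_⟩
        ext i
        fin_cases i
        · simp [vec, h0]
        · simp [vec, h1, hU0, hW0]
        · simp [vec, h2, hU0]
          field_simp
      · have hxE : v 0 / U ∈ E := div_mem (hvE 0) hUE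
        have hwE : c * W / U ∈ E := div_mem (mul_mem hcE hWE) hUE
        refine ⟨some ⟨(⟨_, hxE⟩, ⟨_, hwE⟩), ?_⟩, ?_⟩
        · apply Subtype.ext
          change (c * W / U) ^ p + c * W / U + (v 0 / U) ^ (p + 1) = 0
          rw [div_pow, div_pow, mul_pow, pow_succ U]
          field_simp
          linear_combination htC
        · rw [ht]
          refine (Projectivization.mk_eq_mk_iff' k _ _ _ _).2 ⟨U⁻¹, ?_⟩
          ext i
          fin_cases i
          · change U⁻¹ * v 0 = v 0 / U
            field_simp
          · change U⁻¹ * v 1 = 1 + c * W / U / c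
            rw [h1]
            field_simp
          · change U⁻¹ * v 2 = α + β * (c * W / U / c)
            rw [h2]
            field_simp
  have hcardT := card_affine_points (k := k) (p := p) hn
  have hTfin : Finite T := by
    have : Finite E := Nat.finite_of_card_ne_zero (by
      rw [card_frobSubfield (by omega)]; exact pow_ne_zero _ hp.ne_zero)
    infer_instance
  rw [← hrange, ← Nat.card_coe_set_eq, Nat.card_range_of_injective hginj, Finite.card_option]
  push_cast
  rw [hcardT]
  ring

end RationalPoints

end FermatConics

namespace FermatConics

/-! ### Tangent lines of the Fermat curve and Frobenius. -/

section Hermitian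

variable {k : Type*} [Field k]

/-- Proportionality of vectors. -/
def Par (a b : Fin 3 → k) : Prop := ∀ i j, a i * b j = a j * b i

/-- The coordinatewise `q`-th power. -/
def frob (q : ℕ) (v : Fin 3 → k) : Fin 3 → k := fun i => v i ^ q

/-- The sesquilinear form `∑ aᵢ ^ p bᵢ`. -/
def herm (p : ℕ) (a b : Fin 3 → k) : k := ∑ i, a i ^ p * b i

theorem Par.symm {a b : Fin 3 → k} (h : Par a b) : Par b a := fun i j => by
  rw [mul_comm, ← h i j, mul_comm]

theorem par_iff_crossProduct {a b : Fin 3 → k} : Par a b ↔ crossProduct a b = 0 := by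
  rw [cross_apply]
  constructor
  · intro h
    simp [h 1 2, h 2 0, h 0 1]
  · intro h
    have h0 : a 1 * b 2 - a 2 * b 1 = 0 := congrFun h 0
    have h1 : a 2 * b 0 - a 0 * b 2 = 0 := congrFun h 1
    have h2 : a 0 * b 1 - a 1 * b 0 = 0 := congrFun h 2
    intro i j
    fin_cases i <;> fin_cases j <;> simp only [Fin.zero_eta, Fin.mk_one, Fin.reduceFinMk]
    · linear_combination h2
    · linear_combination -h1
    · linear_combination -h2
    · linear_combination h0
    · linear_combination h1
    · linear_combination -h0

theorem Par.trans {a b n : Fin 3 → k} (hn : n ≠ 0) (ha : Par a n) (hb : Par n b) : Par a b := by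
  obtain ⟨l, hl⟩ := Function.ne_iff.1 hn
  rw [Pi.zero_apply] at hl
  intro i j
  apply mul_left_cancel₀ hl
  apply mul_left_cancel₀ hl
  have := ha i l
  linear_combination n l * b j * ha i l + a l * n i * hb l j - n l * b i * ha j l
    - a l * n j * hb l i

theorem Par.exists_smul {a b : Fin 3 → k} (h : Par a b) (hb : b ≠ 0) : ∃ c : k, a = c • b := by
  obtain ⟨l, hl⟩ := Function.ne_iff.1 hb
  rw [Pi.zero_apply] at hl
  refine ⟨a l / b l, ?_⟩
  ext i
  rw [Pi.smul_apply, smul_eq_mul, div_mul_eq_mul_div, eq_div_iff hl, h i l]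

theorem par_crossProduct {a v w : Fin 3 → k} (hv : ∑ i, a i * v i = 0)
    (hw : ∑ i, a i * w i = 0) : Par a (crossProduct v w) := by
  rw [Fin.sum_univ_three] at hv hw
  rw [par_iff_crossProduct, cross_apply, cross_apply]
  ext i
  fin_cases i
  · simp; linear_combination v 0 * hw - w 0 * hv
  · simp; linear_combination v 1 * hw - w 1 * hv
  · simp; linear_combination v 2 * hw - w 2 * hv

theorem par_of_orthogonal {a b v w : Fin 3 → k} (h : ¬ Par v w)
    (hav : ∑ i, a i * v i = 0) (haw : ∑ i, a i * w i = 0)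
    (hbv : ∑ i, b i * v i = 0) (hbw : ∑ i, b i * w i = 0) : Par a b :=
  (par_crossProduct hav haw).trans (fun h0 => h (par_iff_crossProduct.2 h0))
    (par_crossProduct hbv hbw).symm

theorem frob_ne_zero (q : ℕ) {v : Fin 3 → k} (hv : v ≠ 0) : frob q v ≠ 0 := by
  obtain ⟨l, hl⟩ := Function.ne_iff.1 hv
  exact Function.ne_iff.2 ⟨l, pow_ne_zero q hl⟩

theorem frob_frob (a b : ℕ) (v : Fin 3 → k) : frob a (frob b v) = frob (b * a) v := by
  ext i
  simp [frob, pow_mul]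

theorem frobFixed_iff {q : ℕ} {v : Fin 3 → k} : FrobFixed q v ↔ Par (frob q v) v := Iff.rfl

theorem herm_smul_right (p : ℕ) (a b : Fin 3 → k) (c : k) :
    herm p a (c • b) = c * herm p a b := by
  simp only [herm, Finset.mul_sum, Pi.smul_apply, smul_eq_mul]
  exact Finset.sum_congr rfl fun i _ => by ring

variable {p : ℕ} [Fact p.Prime] [CharP k p]

theorem par_of_par_frob {N : ℕ} {a b : Fin 3 → k} (h : Par (frob (p ^ N) a) (frob (p ^ N) b)) :
    Par a b := by
  intro i j
  apply iterateFrobenius_inj k p N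
  simpa [iterateFrobenius_def, frob, mul_pow] using h i j

theorem herm_frob_frob (N : ℕ) (a b : Fin 3 → k) :
    herm p (frob (p ^ N) a) (frob (p ^ N) b) = herm p a b ^ p ^ N := by
  simp only [herm, frob]
  rw [sum_pow_char_pow]
  refine Finset.sum_congr rfl fun i _ => ?_
  rw [mul_pow, ← pow_mul, ← pow_mul, mul_comm p]

/-- Up to a p-th power, Frobenius exchanges the arguments: the tangent at `a` contains φ(b) exactly
when the tangent at `b` contains `a`. -/
theorem herm_frob_sq (a b : Fin 3 → k) : herm p a (frob (p ^ 2) b) = herm p b a ^ p := by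
  simp only [herm, frob]
  rw [sum_pow_char]
  refine Finset.sum_congr rfl fun i _ => ?_
  rw [mul_pow, ← pow_mul, ← sq, mul_comm]

variable {v : Fin 3 → k}

theorem herm_self_frob (hv : herm p v v = 0) : herm p v (frob (p ^ 2) v) = 0 := by
  rw [herm_frob_sq, hv, zero_pow (Fact.out : p.Prime).ne_zero]

/-- The Gauss map is injective: two vectors with the same polar line are proportional. -/
theorem par_of_herm_eq_zero {a b v w : Fin 3 → k} (h : ¬ Par v w) (hav : herm p a v = 0)
    (haw : herm p a w = 0) (hbv : herm p b v = 0) (hbw : herm p b w = 0) : Par a b := by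
  have := par_of_orthogonal (a := frob p a) (b := frob p b) h hav haw hbv hbw
  rw [← pow_one p] at this
  exact par_of_par_frob this

/-- If v and φ(v) were distinct points, the tangents at both would be the line joining them, against
injectivity of the Gauss map. -/
theorem frobFixed_of_herm_frob (hv : herm p v v = 0) (h : herm p (frob (p ^ 2) v) v = 0) :
    FrobFixed (p ^ 2) v := by
  by_contra hc
  rw [frobFixed_iff] at hc
  refine hc (par_of_herm_eq_zero hc ?_ h (herm_self_frob hv) hv)
  rw [herm_frob_frob, hv, zero_pow (pow_ne_zero _ (Fact.out : p.Prime).ne_zero)]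

/-- The tangent line at `v` meets the curve only in `v` and in its Frobenius conjugate. -/
theorem par_or_par_of_herm_eq_zero (hv : herm p v v = 0) {s : Fin 3 → k}
    (hs : herm p s s = 0) (hvs : herm p v s = 0) : Par s v ∨ Par s (frob (p ^ 2) v) := by
  by_contra! hc
  -- The polar lines of `s` and `v` both contain `s` and φ(v); if these are distinct the lines
  -- agree, and so do `s` and `v`.
  refine hc.1 (par_of_herm_eq_zero hc.2 hs ?_ hvs (herm_self_frob hv))
  rw [herm_frob_sq, hvs, zero_pow (Fact.out : p.Prime).ne_zero]

/-- There are no points of degree two: the tangent at φ(v) contains φ²(v), which would be v, and the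
previous case of a tangent at φ(v) through v applies. -/
theorem frobFixed_of_frobFixed_sq (hv0 : v ≠ 0) (hv : herm p v v = 0)
    (h : FrobFixed (p ^ 4) v) : FrobFixed (p ^ 2) v := by
  have hp := (Fact.out : p.Prime)
  have h1 : herm p (frob (p ^ 2) v) (frob (p ^ 4) v) = 0 := by
    have := herm_self_frob (p := p) (v := frob (p ^ 2) v)
      (by rw [herm_frob_frob, hv, zero_pow (pow_ne_zero _ hp.ne_zero)])
    rwa [frob_frob, ← pow_add] at this
  obtain ⟨c, hc⟩ := (frobFixed_iff.1 h).exists_smul hv0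
  have hc0 : c ≠ 0 := by
    rintro rfl
    rw [zero_smul] at hc
    exact frob_ne_zero _ hv0 hc
  rw [hc, herm_smul_right] at h1
  exact frobFixed_of_herm_frob hv ((mul_eq_zero.1 h1).resolve_left hc0)

/-- The non-vanishing of the polar form on Frobenius conjugates. -/
theorem herm_conj_ne_zero (hv : herm p v v = 0) {m : ℕ}
    (hm : ∀ d, 1 ≤ d → d ≤ m → ¬ FrobFixed (p ^ (2 * d)) v) {i j : ℕ} (hi : i + 1 ≤ m)
    (hj : j ≤ m) (hij : i ≠ j) (hij' : i + 1 ≠ j) :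
    herm p (frob (p ^ (2 * i)) v) (frob (p ^ (2 * j)) v) ≠ 0 := by
  have hp := (Fact.out : p.Prime)
  have hpar : ∀ a b, a < b → b ≤ m → ¬ Par (frob (p ^ (2 * b)) v) (frob (p ^ (2 * a)) v) := by
    intro a b hab hb h
    refine hm (b - a) (by omega) (by omega) ?_
    rw [frobFixed_iff]
    apply par_of_par_frob (p := p) (N := 2 * a)
    rw [frob_frob, ← pow_add]
    convert h using 3
    omega
  have hpar' : ∀ a b, a ≠ b → a ≤ m → b ≤ m →
      ¬ Par (frob (p ^ (2 * b)) v) (frob (p ^ (2 * a)) v) := by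
    intro a b hab ha hb
    rcases lt_or_gt_of_ne hab with h | h
    · exact hpar a b h hb
    · exact fun hc => hpar b a h ha hc.symm
  have hiso : ∀ a, herm p (frob (p ^ (2 * a)) v) (frob (p ^ (2 * a)) v) = 0 := by
    intro a
    rw [herm_frob_frob, hv, zero_pow (pow_ne_zero _ hp.ne_zero)]
  intro h
  -- The tangent at conjugate i meets the curve only in conjugates i and i + 1; `hi` keeps i + 1 in
  -- the range where conjugates are known to be distinct.
  rcases par_or_par_of_herm_eq_zero (hiso i) (hiso j) h with h | h
  · exact hpar' i j hij (by omega) hj h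
  · rw [frob_frob, ← pow_add] at h
    exact hpar' (i + 1) j hij' hi hj h

theorem herm_conj_self (hv : herm p v v = 0) (i : ℕ) :
    herm p (frob (p ^ (2 * i)) v) (frob (p ^ (2 * i)) v) = 0 := by
  rw [herm_frob_frob, hv, zero_pow (pow_ne_zero _ (Fact.out : p.Prime).ne_zero)]

theorem herm_conj_succ (hv : herm p v v = 0) (i : ℕ) :
    herm p (frob (p ^ (2 * i)) v) (frob (p ^ (2 * (i + 1))) v) = 0 := by
  have := herm_self_frob (herm_conj_self hv i)
  rwa [frob_frob, ← pow_add] at this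

end Hermitian

/-! ### Conditions imposed on conics by conjugate points. -/

section Quadrics

variable {k : Type*} [Field k]

/-- The quadratic monomials in three variables. -/
def quadMon {R : Type*} [CommSemiring R] (v : Fin 3 → R) : Fin 6 → R :=
  ![v 0 ^ 2, v 1 ^ 2, v 2 ^ 2, v 0 * v 1, v 1 * v 2, v 0 * v 2]

/-- A linear relation between quadratic monomials, tested on products of two linear forms. -/
theorem sum_mul_mul_eq_zero {r : ℕ} {e : Fin r → Fin 3 → k} {g : Fin r → k}
    (h : ∑ j, g j • quadMon (e j) = 0) (a b : Fin 3 → k) :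
    ∑ j, g j * ((∑ i, a i * e j i) * ∑ i, b i * e j i) = 0 := by
  have h' : ∀ i, ∑ j, g j * quadMon (e j) i = 0 := fun i => by
    simpa using congrFun h i
  have h0 : ∑ j, g j * e j 0 ^ 2 = 0 := h' 0
  have h1 : ∑ j, g j * e j 1 ^ 2 = 0 := h' 1
  have h2 : ∑ j, g j * e j 2 ^ 2 = 0 := h' 2
  have h3 : ∑ j, g j * (e j 0 * e j 1) = 0 := h' 3
  have h4 : ∑ j, g j * (e j 1 * e j 2) = 0 := h' 4
  have h5 : ∑ j, g j * (e j 0 * e j 2) = 0 := h' 5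
  have : ∀ j, g j * ((∑ i, a i * e j i) * ∑ i, b i * e j i) =
      a 0 * b 0 * (g j * e j 0 ^ 2) + a 1 * b 1 * (g j * e j 1 ^ 2) +
      a 2 * b 2 * (g j * e j 2 ^ 2) + (a 0 * b 1 + a 1 * b 0) * (g j * (e j 0 * e j 1)) +
      (a 1 * b 2 + a 2 * b 1) * (g j * (e j 1 * e j 2)) +
      (a 0 * b 2 + a 2 * b 0) * (g j * (e j 0 * e j 2)) := by
    intro j
    simp only [Fin.sum_univ_three]
    ring
  rw [Finset.sum_congr rfl fun j _ => this j]
  simp only [Finset.sum_add_distrib, ← Finset.mul_sum, h0, h1, h2, h3, h4, h5]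
  ring

theorem quadMon_ne_zero {v : Fin 3 → k} (hv : v ≠ 0) : quadMon v ≠ 0 := by
  intro h
  apply hv
  have h0 : v 0 ^ 2 = 0 := congrFun h 0
  have h1 : v 1 ^ 2 = 0 := congrFun h 1
  have h2 : v 2 ^ 2 = 0 := congrFun h 2
  ext i
  fin_cases i
  exacts [eq_zero_of_pow_eq_zero h0, eq_zero_of_pow_eq_zero h1, eq_zero_of_pow_eq_zero h2]

variable {p : ℕ} [Fact p.Prime] [CharP k p] {v : Fin 3 → k}

/-- The table of values of the tangent forms at the Frobenius conjugates of a point. -/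
theorem exists_tangent_table (hv : herm p v v = 0) {m : ℕ}
    (hm : ∀ d, 1 ≤ d → d ≤ m → ¬ FrobFixed (p ^ (2 * d)) v) :
    ∃ T : ℕ → ℕ → k,
      (∀ (r : ℕ) (g : Fin r → k), ∑ j, g j • quadMon (frob (p ^ (2 * (j : ℕ))) v) = 0 →
        ∀ i l, ∑ j, g j * (T i j * T l j) = 0) ∧
      (∀ i, T i i = 0) ∧ (∀ i, T i (i + 1) = 0) ∧
      ∀ i j, i + 1 ≤ m → j ≤ m → i ≠ j → i + 1 ≠ j → T i j ≠ 0 :=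
  ⟨fun i j => herm p (frob (p ^ (2 * i)) v) (frob (p ^ (2 * j)) v),
    fun _ _ hg _ _ => sum_mul_mul_eq_zero hg _ _, herm_conj_self hv, herm_conj_succ hv,
    fun _ _ => herm_conj_ne_zero hv hm⟩

/-- The Frobenius conjugates of a point that is not rational over a small field impose
independent conditions on conics. -/
theorem linearIndependent_quadMon_three (hv0 : v ≠ 0) (hv : herm p v v = 0)
    (hm : ∀ d, 1 ≤ d → d ≤ 2 → ¬ FrobFixed (p ^ (2 * d)) v) :
    LinearIndependent k fun j : Fin 3 => quadMon (frob (p ^ (2 * (j : ℕ))) v) := by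
  rw [Fintype.linearIndependent_iff]
  intro g hg
  obtain ⟨T, rel, s, t, n⟩ := exists_tangent_table hv hm
  replace rel := rel 3 g hg
  simp only [Fin.sum_univ_three, Fin.coe_ofNat_eq_mod, Nat.zero_mod, Nat.one_mod, Nat.reduceMod]
    at rel
  -- The double tangent at conjugate 0 vanishes at 0 and 1 only, that at conjugate 1 at 1 and 2
  -- only; each isolates one coefficient.
  have g2 : g 2 = 0 := by simpa [s, t 0, n 0 2] using rel 0 0
  have g0 : g 0 = 0 := by simpa [s, t 1, n 1 0] using rel 1 1
  have g1 : g 1 = 0 := by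
    rw [Fin.sum_univ_three, g0, g2, zero_smul, zero_smul, zero_add, add_zero, smul_eq_zero] at hg
    exact hg.resolve_right (quadMon_ne_zero (frob_ne_zero _ hv0))
  intro j
  fin_cases j
  exacts [g0, g1, g2]

theorem linearIndependent_quadMon_four (hv : herm p v v = 0)
    (hm : ∀ d, 1 ≤ d → d ≤ 3 → ¬ FrobFixed (p ^ (2 * d)) v) :
    LinearIndependent k fun j : Fin 4 => quadMon (frob (p ^ (2 * (j : ℕ))) v) := by
  rw [Fintype.linearIndependent_iff]
  intro g hg
  obtain ⟨T, rel, s, t, n⟩ := exists_tangent_table hv hm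
  replace rel := rel 4 g hg
  simp only [Fin.sum_univ_four, Fin.coe_ofNat_eq_mod, Nat.zero_mod, Nat.one_mod, Nat.reduceMod]
    at rel
  have g3 : g 3 = 0 := by simpa [s, t 0, t 1, n 0 3, n 1 3] using rel 0 1
  have g0 : g 0 = 0 := by simpa [s, t 1, t 2, n 1 0, n 2 0] using rel 1 2
  have g2 : g 2 = 0 := by simpa [s, t 0, g3, n 0 2] using rel 0 0
  have g1 : g 1 = 0 := by simpa [s, t 2, g0, n 2 1] using rel 2 2
  intro j
  fin_cases j
  exacts [g0, g1, g2, g3]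

/-- A product of tangents i and l vanishes at conjugates i, i + 1, l, l + 1. The pairs (0, 2), (1,
3), (0, 3) isolate coefficients 4, 0, 2; double tangents then separate the remaining two. -/
theorem linearIndependent_quadMon_five (hv : herm p v v = 0)
    (hm : ∀ d, 1 ≤ d → d ≤ 4 → ¬ FrobFixed (p ^ (2 * d)) v) :
    LinearIndependent k fun j : Fin 5 => quadMon (frob (p ^ (2 * (j : ℕ))) v) := by
  rw [Fintype.linearIndependent_iff]
  intro g hg
  obtain ⟨T, rel, s, t, n⟩ := exists_tangent_table hv hm
  replace rel := rel 5 g hg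
  simp only [Fin.sum_univ_five, Fin.coe_ofNat_eq_mod, Nat.zero_mod, Nat.one_mod, Nat.reduceMod]
    at rel
  have g4 : g 4 = 0 := by simpa [s, t 0, t 2, n 0 4, n 2 4] using rel 0 2
  have g0 : g 0 = 0 := by simpa [s, t 1, t 3, n 1 0, n 3 0] using rel 1 3
  have g2 : g 2 = 0 := by simpa [s, t 0, t 3, n 0 2, n 3 2] using rel 0 3
  have g3 : g 3 = 0 := by simpa [s, t 0, g2, g4, n 0 3] using rel 0 0
  have g1 : g 1 = 0 := by simpa [s, t 2, g0, g4, n 2 1] using rel 2 2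
  intro j
  fin_cases j
  exacts [g0, g1, g2, g3, g4]

end Quadrics

end FermatConics

namespace FermatConics

open MvPolynomial

/-! ### Quadratic forms over F evaluated at points over k. -/

section Conics

variable {F : Type*} [Field F]

theorem aeval_linearCombination_quadMon {A : Type*} [CommRing A] [Algebra F A] (v : Fin 3 → A)
    (c : Fin 6 → F) :
    aeval v (Fintype.linearCombination F (quadMon (X : Fin 3 → MvPolynomial (Fin 3) F)) c) =
      Fintype.linearCombination F (quadMon v) c := by
  simp [Fintype.linearCombination_apply, quadMon, Fin.sum_univ_succ]

theorem linearCombination_quadMon_mem (c : Fin 6 → F) :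
    Fintype.linearCombination F (quadMon (X : Fin 3 → MvPolynomial (Fin 3) F)) c ∈
      homogeneousSubmodule (Fin 3) F 2 := by
  rw [Fintype.linearCombination_apply]
  refine Submodule.sum_mem _ fun i _ => Submodule.smul_mem _ _ ?_
  rw [mem_homogeneousSubmodule]
  have hX := fun j : Fin 3 => isHomogeneous_X F j
  fin_cases i
  · simpa [quadMon] using (hX 0).pow 2
  · simpa [quadMon] using (hX 1).pow 2
  · simpa [quadMon] using (hX 2).pow 2
  · exact (hX 0).mul (hX 1)
  · exact (hX 1).mul (hX 2)
  · exact (hX 0).mul (hX 2)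

theorem exists_linearCombination_quadMon {f : MvPolynomial (Fin 3) F} (hf : f.IsHomogeneous 2) :
    f ∈ LinearMap.range
      (Fintype.linearCombination F (quadMon (X : Fin 3 → MvPolynomial (Fin 3) F))) := by
  rw [f.as_sum]
  refine Submodule.sum_mem _ fun d hd => ?_
  have hd' : d.degree = 2 := by
    rw [Finsupp.degree_eq_weight_one]; exact hf (mem_support_iff.1 hd)
  rw [Finsupp.degree_eq_sum, Fin.sum_univ_three] at hd'
  rw [monomial_eq, Finsupp.prod_fintype _ _ (by simp), Fin.prod_univ_three, C_mul']
  refine Submodule.smul_mem _ _ ?_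
  rw [Fintype.range_linearCombination]
  have key : ∀ i : Fin 6, quadMon (X : Fin 3 → MvPolynomial (Fin 3) F) i ∈
      Submodule.span F (Set.range (quadMon (X : Fin 3 → MvPolynomial (Fin 3) F))) :=
    fun i => Submodule.subset_span ⟨i, rfl⟩
  generalize d 0 = a at *
  generalize d 1 = b at *
  generalize d 2 = c at *
  have ha : a ≤ 2 := by omega
  have hb : b ≤ 2 := by omega
  obtain rfl : c = 2 - a - b := by omega
  interval_cases a <;> interval_cases b <;> first | omega | skip
  · simpa [quadMon] using key 2
  · simpa [quadMon] using key 4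
  · simpa [quadMon] using key 1
  · simpa [quadMon] using key 5
  · simpa [quadMon] using key 3
  · simpa [quadMon] using key 0

/-- Quadratic forms in three variables are given by their six coefficients. -/
noncomputable def quadEquiv (F : Type*) [Field F] :
    (Fin 6 → F) ≃ₗ[F] homogeneousSubmodule (Fin 3) F 2 :=
  LinearEquiv.ofBijective
    (LinearMap.codRestrict _
      (Fintype.linearCombination F (quadMon (X : Fin 3 → MvPolynomial (Fin 3) F)))
      linearCombination_quadMon_mem) (by
    constructor
    · rw [← LinearMap.ker_eq_bot, LinearMap.ker_codRestrict, LinearMap.ker_eq_bot']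
      intro c hc
      have h : ∀ v : Fin 3 → F, Fintype.linearCombination F (quadMon v) c = 0 := fun v => by
        rw [← aeval_linearCombination_quadMon, hc, map_zero]
      have h0 := h ![1, 0, 0]
      have h1 := h ![0, 1, 0]
      have h2 := h ![0, 0, 1]
      have h3 := h ![1, 1, 0]
      have h4 := h ![0, 1, 1]
      have h5 := h ![1, 0, 1]
      simp [Fintype.linearCombination_apply, quadMon, Fin.sum_univ_succ] at h0 h1 h2 h3 h4 h5
      simp only [h0, h1, h2, zero_add] at h3 h4 h5
      ext i
      fin_cases i
      exacts [h0, h1, h2, h3, h4, h5]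
    · rintro ⟨f, hf⟩
      obtain ⟨c, hc⟩ := exists_linearCombination_quadMon hf
      exact ⟨c, Subtype.ext hc⟩)

theorem finrank_quadrics : Module.finrank F (homogeneousSubmodule (Fin 3) F 2) = 6 := by
  rw [← (quadEquiv F).finrank_eq, Module.finrank_fin_fun]

variable {k : Type*} [Field k] [Algebra F k]

/-- Evaluation of quadratic forms over `F` at a vector over `k`. -/
noncomputable def quadEval (F : Type*) [Field F] [Algebra F k] (v : Fin 3 → k) :
    homogeneousSubmodule (Fin 3) F 2 →ₗ[F] k :=
  (aeval v).toLinearMap ∘ₗ (homogeneousSubmodule (Fin 3) F 2).subtype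

theorem quadEval_quadEquiv (v : Fin 3 → k) (c : Fin 6 → F) :
    quadEval F v (quadEquiv F c) = Fintype.linearCombination F (quadMon v) c :=
  aeval_linearCombination_quadMon v c

theorem finrank_ker_quadEval (v : Fin 3 → k) :
    Module.finrank F (LinearMap.ker (quadEval F v)) =
      Module.finrank F (LinearMap.ker (Fintype.linearCombination F (quadMon v))) := by
  have h : LinearMap.ker (quadEval F v) =
      (LinearMap.ker (Fintype.linearCombination F (quadMon v))).map
        (quadEquiv F : (Fin 6 → F) →ₗ[F] _) := by
    ext Q
    obtain ⟨c, rfl⟩ := (quadEquiv F).surjective Q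
    rw [LinearMap.mem_ker, quadEval_quadEquiv]
    simp
  rw [h, LinearEquiv.finrank_map_eq]

/-- A space of quadratic forms over `F` satisfying `r` independent conditions over `k`. -/
theorem finrank_add_le_of_linearIndependent (W : Submodule F (Fin 6 → F)) {r : ℕ}
    {e : Fin r → Fin 6 → k} (he : LinearIndependent k e)
    (h : ∀ c ∈ W, ∀ j, Fintype.linearCombination F (e j) c = 0) :
    Module.finrank F W + r ≤ 6 := by
  let M : Matrix (Fin r) (Fin 6) k := Matrix.of e
  have hrank : M.rank = r := by
    have := LinearIndependent.rank_matrix (M := M) he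
    simpa using this
  let b := Module.finBasis F W
  have hb : LinearIndependent F fun i => (b i : Fin 6 → F) :=
    b.linearIndependent.map' W.subtype W.ker_subtype
  -- Vectors independent over F stay independent over k, so the F-dimension of `W` is at most the
  -- k-dimension of the solution space.
  have hb' := (linearIndependent_algebraMap_comp_iff (S := k)).2 hb
  have hmem : ∀ i, algebraMap F k ∘ (b i : Fin 6 → F) ∈ LinearMap.ker M.mulVecLin := by
    intro i
    rw [LinearMap.mem_ker]
    ext j
    have := h _ (b i).2 j
    simp only [Fintype.linearCombination_apply, Algebra.smul_def] at this
    simpa [M, Matrix.mulVec, dotProduct, mul_comm] using this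
  have hli : LinearIndependent k fun i => (⟨_, hmem i⟩ : LinearMap.ker M.mulVecLin) :=
    LinearIndependent.of_comp (LinearMap.ker M.mulVecLin).subtype hb'
  have h1 := hli.fintype_card_le_finrank
  have h2 := M.mulVecLin.finrank_range_add_finrank_ker
  rw [Module.finrank_fin_fun] at h2
  rw [Fintype.card_fin] at h1
  have h3 : Module.finrank k (LinearMap.range M.mulVecLin) = r := hrank
  omega

theorem quadEval_smul (v : Fin 3 → k) (a : k) (Q : homogeneousSubmodule (Fin 3) F 2) :
    quadEval F (a • v) Q = a ^ 2 * quadEval F v Q := by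
  obtain ⟨c, rfl⟩ := (quadEquiv F).surjective Q
  rw [quadEval_quadEquiv, quadEval_quadEquiv]
  simp [Fintype.linearCombination_apply, quadMon, Fin.sum_univ_succ, Algebra.smul_def]
  ring

theorem ker_quadEval_smul (v : Fin 3 → k) {a : k} (ha : a ≠ 0) :
    LinearMap.ker (quadEval F (a • v)) = LinearMap.ker (quadEval F v) := by
  ext Q
  simp [quadEval_smul, ha]

theorem algebraMap_pow_card [Finite F] {p : ℕ} (hF : Nat.card F = p ^ 2) (c : F) (n : ℕ) :
    algebraMap F k c ^ p ^ (2 * n) = algebraMap F k c := by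
  have := Fintype.ofFinite F
  rw [← map_pow, pow_mul, ← hF, Nat.card_eq_fintype_card, FiniteField.pow_card_pow]

variable {p : ℕ} [Fact p.Prime] [CharP k p] [Finite F]

/-- The coefficients are fixed by φ, so a conic over F through a point contains its conjugates. -/
theorem linearCombination_quadMon_frob (hF : Nat.card F = p ^ 2) {v : Fin 3 → k} {c : Fin 6 → F}
    (h : Fintype.linearCombination F (quadMon v) c = 0) (n : ℕ) :
    Fintype.linearCombination F (quadMon (frob (p ^ (2 * n)) v)) c = 0 := by
  have hmon : ∀ i, quadMon (frob (p ^ (2 * n)) v) i = quadMon v i ^ p ^ (2 * n) := by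
    intro i
    fin_cases i <;> simp [quadMon, frob, mul_pow, ← pow_mul, mul_comm]
  rw [Fintype.linearCombination_apply] at h ⊢
  have := congrArg (· ^ p ^ (2 * n)) h
  simp only [sum_pow_char_pow] at this
  rw [zero_pow (pow_ne_zero _ (Fact.out : p.Prime).ne_zero)] at this
  rw [← this]
  refine Finset.sum_congr rfl fun i _ => ?_
  rw [hmon, Algebra.smul_def, Algebra.smul_def, mul_pow, algebraMap_pow_card hF]

theorem finrank_ker_add_le (hF : Nat.card F = p ^ 2) {v : Fin 3 → k} {r : ℕ}
    (h : LinearIndependent k fun j : Fin r => quadMon (frob (p ^ (2 * (j : ℕ))) v)) :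
    Module.finrank F (LinearMap.ker (quadEval F v)) + r ≤ 6 := by
  rw [finrank_ker_quadEval]
  exact finrank_add_le_of_linearIndependent _ h fun c hc j =>
    linearCombination_quadMon_frob hF (LinearMap.mem_ker.1 hc) j

/-- At a representative normalized to have coordinates in the field with p^(2n) elements, evaluation
takes values in that field, so its rank over F is at most n. -/
theorem le_finrank_ker [IsAlgClosed k] (hF : Nat.card F = p ^ 2) {v : Fin 3 → k} (hv0 : v ≠ 0)
    {n : ℕ} (hn : n ≠ 0) (hv : FrobFixed (p ^ (2 * n)) v) :
    6 ≤ Module.finrank F (LinearMap.ker (quadEval F v)) + n := by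
  have hp := (Fact.out : p.Prime)
  obtain ⟨a, ha0, ha⟩ := hv.exists_smul hv0
  rw [← ker_quadEval_smul v ha0]
  set w := a • v
  have hfin : Module.Finite F (homogeneousSubmodule (Fin 3) F 2) :=
    Module.Finite.equiv (quadEquiv F)
  have h1 := (quadEval F w).finrank_range_add_finrank_ker
  rw [finrank_quadrics] at h1
  have hle : ∀ x ∈ LinearMap.range (quadEval F w), x ∈ frobSubfield k p (2 * n) := by
    rintro _ ⟨Q, rfl⟩
    obtain ⟨c, rfl⟩ := (quadEquiv F).surjective Q
    rw [quadEval_quadEquiv, Fintype.linearCombination_apply]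
    have hw : ∀ i, w i ∈ frobSubfield k p (2 * n) := ha
    refine sum_mem fun i _ => ?_
    rw [Algebra.smul_def]
    refine mul_mem (algebraMap_pow_card hF _ _) ?_
    fin_cases i
    exacts [pow_mem (hw 0) 2, pow_mem (hw 1) 2, pow_mem (hw 2) 2, mul_mem (hw 0) (hw 1),
      mul_mem (hw 1) (hw 2), mul_mem (hw 0) (hw 2)]
  have hcard := card_frobSubfield (k := k) (p := p) (N := 2 * n) (by omega)
  have hfinE : Finite (frobSubfield k p (2 * n)) :=
    Nat.finite_of_card_ne_zero (by rw [hcard]; exact pow_ne_zero _ hp.ne_zero)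
  have h2 : Nat.card (LinearMap.range (quadEval F w)) ≤ Nat.card (frobSubfield k p (2 * n)) :=
    Nat.card_le_card_of_injective (fun x => ⟨x.1, hle _ x.2⟩) fun x y h =>
      Subtype.ext (by simpa using h)
  rw [hcard, Module.natCard_eq_pow_finrank (K := F), hF, ← pow_mul] at h2
  have h3 := (Nat.pow_le_pow_iff_right hp.one_lt).1 h2
  omega

end Conics
end FermatConics

namespace FermatConics

open MvPolynomial

/-! ### The number of conics through a point. -/

section ConicsThroughPoint

variable {F : Type*} [Field F] {k : Type*} [Field k] [Algebra F k]

theorem mem_points_iff (Q : Conic F) (t : Plane k) :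
    t ∈ Q.points k ↔ Q.rep ∈ LinearMap.ker (quadEval F t.rep) := by
  rw [Conic.points, zeroLocus, Set.mem_ofPred_eq, Conic.form, eval_map, LinearMap.mem_ker]
  rfl

theorem ncard_setOf_rep_mem {V : Type*} [AddCommGroup V] [Module F V] (W : Submodule F V) :
    {Q : Projectivization F V | Q.rep ∈ W}.ncard = Nat.card (Projectivization F W) := by
  have hinj : Function.Injective (Projectivization.map W.subtype W.injective_subtype) :=
    Projectivization.map_injective _ _
  rw [← Nat.card_range_of_injective hinj, ← Nat.card_coe_set_eq]
  congr 2
  ext Q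
  constructor
  · intro hQ
    refine ⟨Projectivization.mk F ⟨Q.rep, hQ⟩ fun h => Q.rep_nonzero (congrArg Subtype.val h), ?_⟩
    rw [Projectivization.map_mk]
    exact Q.mk_rep
  · rintro ⟨R, rfl⟩
    induction R using Projectivization.ind with | _ w hw
    rw [Projectivization.map_mk]
    obtain ⟨a, ha⟩ := Projectivization.exists_smul_eq_mk_rep F (W.subtype w)
      (fun h => hw (Subtype.ext h))
    change Projectivization.rep _ ∈ W
    rw [← ha]
    exact W.smul_mem _ w.2

theorem ncard_conics_through [Finite F] (t : Plane k) :
    {Q : Conic F | t ∈ Q.points k}.ncard =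
      ∑ i ∈ Finset.range (Module.finrank F (LinearMap.ker (quadEval F t.rep))),
        Nat.card F ^ i := by
  simp only [mem_points_iff]
  rw [ncard_setOf_rep_mem, Projectivization.card_of_finrank F _ rfl]

theorem card_conic [Finite F] : Nat.card (Conic F) = ∑ i ∈ Finset.range 6, Nat.card F ^ i :=
  Projectivization.card_of_finrank F _ finrank_quadrics

theorem finite_conic [Finite F] : Finite (Conic F) := by
  refine Nat.finite_of_card_ne_zero ?_
  rw [card_conic, Finset.sum_range_succ']
  simp

theorem mem_fermatCurve_iff_herm {p : ℕ} {t : Plane k} :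
    t ∈ fermatCurve k p ↔ herm p t.rep t.rep = 0 := by
  conv_lhs => rw [← t.mk_rep]
  rw [mk_mem_fermatCurve_iff]
  simp [herm, Fin.sum_univ_three, pow_succ]

variable {p : ℕ} [Fact p.Prime] [CharP k p]

/-- Since φ³ and φ⁴ both fix the point, φ³(φ(v)) and φ³(v) are proportional, and φ³ can be
cancelled. -/
theorem FrobFixed.of_three_of_four {v : Fin 3 → k} (hv0 : v ≠ 0) (h3 : FrobFixed (p ^ 6) v)
    (h4 : FrobFixed (p ^ 8) v) : FrobFixed (p ^ 2) v := by
  rw [frobFixed_iff] at *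
  apply par_of_par_frob (p := p) (N := 6)
  rw [frob_frob, ← pow_add]
  exact h4.trans hv0 h3.symm

variable [Finite F]

/-- Degree 2 does not occur on the curve, so the exclusions make the first five conjugates distinct
and they impose five conditions. -/
theorem finrank_ker_le_one (hF : Nat.card F = p ^ 2) {t : Plane k} (ht : t ∈ fermatCurve k p)
    (ht1 : t ∉ rationalPoints k p (p ^ 2)) (ht3 : t ∉ rationalPoints k p (p ^ 6))
    (ht4 : t ∉ rationalPoints k p (p ^ 8)) :
    Module.finrank F (LinearMap.ker (quadEval F t.rep)) ≤ 1 := by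
  have hv := mem_fermatCurve_iff_herm.1 ht
  have hf : ¬ FrobFixed (p ^ 2) t.rep := fun h => ht1 ⟨ht, h⟩
  have h2 := finrank_ker_add_le hF (linearIndependent_quadMon_five hv (by
    intro d hd1 hd2
    interval_cases d
    · exact hf
    · exact fun h => hf (frobFixed_of_frobFixed_sq t.rep_nonzero hv h)
    · exact fun h => ht3 ⟨ht, h⟩
    · exact fun h => ht4 ⟨ht, h⟩))
  omega

variable [IsAlgClosed k]

theorem finrank_ker_of_one (hF : Nat.card F = p ^ 2) {t : Plane k}
    (ht : t ∈ rationalPoints k p (p ^ 2)) :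
    Module.finrank F (LinearMap.ker (quadEval F t.rep)) = 5 := by
  have h1 := le_finrank_ker hF t.rep_nonzero one_ne_zero (by simpa using ht.2)
  have h2 := finrank_ker_add_le (F := F) hF (v := t.rep) (r := 1) (by
    rw [linearIndependent_unique_iff]
    exact quadMon_ne_zero (frob_ne_zero _ t.rep_nonzero))
  omega

/-- The value field bounds the number of conditions by 3, and three distinct conjugates attain it.
-/
theorem finrank_ker_of_three (hF : Nat.card F = p ^ 2) {t : Plane k}
    (ht : t ∈ rationalPoints k p (p ^ 6)) (ht1 : t ∉ rationalPoints k p (p ^ 2)) :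
    Module.finrank F (LinearMap.ker (quadEval F t.rep)) = 3 := by
  have hv := mem_fermatCurve_iff_herm.1 ht.1
  have hf : ¬ FrobFixed (p ^ 2) t.rep := fun h => ht1 ⟨ht.1, h⟩
  have h1 := le_finrank_ker hF t.rep_nonzero (n := 3) (by norm_num) (by simpa using ht.2)
  have h2 := finrank_ker_add_le hF (linearIndependent_quadMon_three t.rep_nonzero hv (by
    intro d hd1 hd2
    interval_cases d
    · exact hf
    · exact fun h => hf (frobFixed_of_frobFixed_sq t.rep_nonzero hv h)))
  omega

theorem finrank_ker_of_four (hF : Nat.card F = p ^ 2) {t : Plane k}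
    (ht : t ∈ rationalPoints k p (p ^ 8)) (ht1 : t ∉ rationalPoints k p (p ^ 2)) :
    Module.finrank F (LinearMap.ker (quadEval F t.rep)) = 2 := by
  have hv := mem_fermatCurve_iff_herm.1 ht.1
  have hf : ¬ FrobFixed (p ^ 2) t.rep := fun h => ht1 ⟨ht.1, h⟩
  have h1 := le_finrank_ker hF t.rep_nonzero (n := 4) (by norm_num) (by simpa using ht.2)
  have h2 := finrank_ker_add_le hF (linearIndependent_quadMon_four hv (by
    intro d hd1 hd2
    interval_cases d
    · exact hf
    · exact fun h => hf (frobFixed_of_frobFixed_sq t.rep_nonzero hv h)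
    · exact fun h => hf (FrobFixed.of_three_of_four t.rep_nonzero h ht.2)))
  omega

end ConicsThroughPoint

/-! ### Bézout with the tangency error. -/

section Error

variable {F : Type*} [Field F] {k : Type*} [Field k] [Algebra F k]

theorem isHomogeneous_form (Q : Conic F) : (Q.form k).IsHomogeneous 2 := by
  have : (Q.rep : MvPolynomial (Fin 3) F).IsHomogeneous 2 := Q.rep.2
  exact this.map _

theorem form_ne_zero (Q : Conic F) : Q.form k ≠ 0 := by
  intro h
  rw [Conic.form, map_eq_zero_iff _ (map_injective _ (algebraMap F k).injective)] at h
  exact Q.rep_nonzero (Subtype.ext h)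

theorem not_fermatForm_dvd_form {p : ℕ} (hp : 2 ≤ p) (Q : Conic F) :
    ¬ fermatForm k p ∣ Q.form k := by
  rintro ⟨c, hc⟩
  have h0 := form_ne_zero (k := k) Q
  have hG : fermatForm k p ≠ 0 := fun h => h0 (by rw [hc, h, zero_mul])
  have hc0 : c ≠ 0 := fun h => h0 (by rw [hc, h, mul_zero])
  have h1 := (isHomogeneous_form Q).totalDegree h0
  rw [hc, totalDegree_mul_of_isDomain hG hc0, (isHomogeneous_fermatForm k p).totalDegree hG] at h1
  omega

theorem mem_inter_points_iff {p : ℕ} (Q : Conic F) (t : Plane k) :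
    t ∈ fermatCurve k p ∩ Q.points k ↔
      intersectionMult (fermatForm k p) (Q.form k) t ≠ 0 :=
  (intersectionMult_ne_zero_iff (isHomogeneous_fermatForm k p) (isHomogeneous_form Q) t).symm

variable {p : ℕ} [Fact p.Prime] [CharP k p] [IsAlgClosed k]

theorem totalMult_fermatForm_form (Q : Conic F) :
    totalMult (fermatForm k p) (Q.form k) = (2 * (p + 1) : ℕ) :=
  totalMult_fermatForm cast_succ_ne_zero (isHomogeneous_form Q)
    (not_fermatForm_dvd_form (Fact.out : p.Prime).two_le Q)

theorem intersectionMult_form_ne_top (Q : Conic F) (t : Plane k) :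
    intersectionMult (fermatForm k p) (Q.form k) t ≠ ⊤ := by
  have h := totalMult_fermatForm_form (k := k) (p := p) Q
  have := ENNReal.ne_top_of_tsum_ne_top (h ▸ ENNReal.natCast_ne_top _) t
  simpa using this

theorem finite_inter_points (p : ℕ) [Fact p.Prime] [CharP k p] (Q : Conic F) :
    (fermatCurve k p ∩ Q.points k).Finite := by
  have h := totalMult_fermatForm_form (k := k) (p := p) Q
  refine (ENNReal.finite_const_le_of_tsum_ne_top (h ▸ ENNReal.natCast_ne_top _)
    one_ne_zero).subset fun t ht => ?_
  rw [mem_inter_points_iff, ← Order.one_le_iff_ne_zero] at ht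
  rw [Set.mem_ofPred_eq]
  exact_mod_cast ht

/-- Bézout's theorem, as a formula for the number of intersection points. -/
theorem ncard_inter_points_add_conicError (Q : Conic F) :
    (fermatCurve k p ∩ Q.points k).ncard + conicError k p Q = 2 * (p + 1) := by
  classical
  have hfin := finite_inter_points (k := k) p Q
  set S := hfin.toFinset with hS
  set f : Plane k → ℕ := fun t => (intersectionMult (fermatForm k p) (Q.form k) t).toNat with hf
  have hcoe : ∀ t, (f t : ℕ∞) = intersectionMult (fermatForm k p) (Q.form k) t := fun t =>
    ENat.natCast_toNat (intersectionMult_form_ne_top Q t)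
  have hmem : ∀ t, t ∈ S ↔ f t ≠ 0 := by
    intro t
    rw [hS, Set.Finite.mem_toFinset, mem_inter_points_iff, ← hcoe]
    simp
  have hsum : ∑ t ∈ S, f t = 2 * (p + 1) := by
    have h := totalMult_fermatForm_form (k := k) (p := p) Q
    rw [totalMult, tsum_eq_sum (s := S)] at h
    · simp only [← hcoe, ENat.toENNReal_coe] at h
      exact_mod_cast h
    · intro t ht
      rw [hmem, not_not] at ht
      rw [← hcoe, ht]
      simp
  have herr : ∀ r, (∑ᶠ _ : 2 ≤ r, errorAt k p Q r) = (S.filter fun t => f t = r).card * (r - 1) := by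
    intro r
    have h1 : {t ∈ fermatCurve k p ∩ Q.points k |
        intersectionMult (fermatForm k p) (Q.form k) t = r} = ↑(S.filter fun t => f t = r) := by
      ext t
      rw [Finset.coe_filter, hS, Set.mem_ofPred_eq, Set.mem_ofPred_eq, Set.Finite.mem_toFinset,
        ← hcoe, Nat.cast_inj]
    rw [finsum_eq_if, errorAt, h1, Set.ncard_coe_finset]
    split_ifs with h
    · rfl
    -- For r < 2 the truncated factor r - 1 is zero, so the restriction to r ≥ 2 can be dropped.
    · rw [show r - 1 = 0 by omega, mul_zero]
  have hconic : conicError k p Q = ∑ t ∈ S, (f t - 1) := by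
    rw [conicError, finsum_congr herr, finsum_eq_sum_of_support_subset (s := S.image f),
      Finset.sum_comp (fun r => r - 1) f]
    · simp
    · intro r hr
      rw [Function.mem_support] at hr
      have := Finset.card_ne_zero.1 (left_ne_zero_of_mul hr)
      obtain ⟨t, ht⟩ := this
      rw [Finset.mem_filter] at ht
      exact Finset.mem_coe.2 (Finset.mem_image.2 ⟨t, ht⟩)
  rw [hconic, Set.ncard_eq_toFinset_card _ hfin, ← hS, Finset.card_eq_sum_ones,
    ← Finset.sum_add_distrib, ← hsum]
  refine Finset.sum_congr rfl fun t ht => ?_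
  have := (hmem t).1 ht
  omega

end Error
end FermatConics

namespace FermatConics

/-! ### Double counting of incidences. -/

section DoubleCounting

theorem rationalPoints_subset {k : Type*} [Field k] {p : ℕ} [Fact p.Prime] [CharP k p] {n : ℕ} :
    rationalPoints k p (p ^ 2) ⊆ rationalPoints k p (p ^ (2 * n)) := by
  rintro t ⟨ht, h⟩
  refine ⟨ht, ?_⟩
  obtain ⟨a, ha0, ha⟩ := h.exists_smul t.rep_nonzero
  have : FrobFixed (p ^ (2 * n)) (a • t.rep) :=
    frobFixed_of_pow_eq fun i => mem_frobSubfield_of_pow_sq (ha i)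
  simpa [smul_smul, ha0] using this.smul a⁻¹

variable {F : Type*} [Field F] [Finite F] {k : Type*} [Field k] [Algebra F k] [IsAlgClosed k]
  {p : ℕ} [Fact p.Prime] [CharP k p]

theorem finite_inter_conicUnion (F : Type*) [Field F] [Finite F] (k : Type*) [Field k]
    [Algebra F k] [IsAlgClosed k] (p : ℕ) [Fact p.Prime] [CharP k p] :
    (fermatCurve k p ∩ conicUnion F k).Finite := by
  have := finite_conic (F := F)
  rw [conicUnion, Set.inter_iUnion]
  exact Set.finite_iUnion fun Q => finite_inter_points p Q

theorem sum_ncard_inter_points [Fintype (Conic F)] :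
    ∑ Q : Conic F, (fermatCurve k p ∩ Q.points k).ncard =
      ∑ t ∈ (finite_inter_conicUnion F k p).toFinset, {Q : Conic F | t ∈ Q.points k}.ncard := by
  classical
  have h := Finset.sum_card_bipartiteAbove_eq_sum_card_bipartiteBelow
    (s := (Finset.univ : Finset (Conic F))) (t := (finite_inter_conicUnion F k p).toFinset)
    fun Q t => t ∈ Q.points k
  rw [Finset.sum_congr rfl fun Q _ => ?_, h, Finset.sum_congr rfl fun t _ => ?_]
  · rw [← Set.ncard_coe_finset]
    congr 1
    ext Q
    simp [Finset.bipartiteBelow]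
  · rw [← Set.ncard_coe_finset]
    congr 1
    ext t
    simp only [Finset.bipartiteAbove, Finset.coe_filter, Set.Finite.mem_toFinset,
      Set.mem_ofPred_eq, Set.mem_inter_iff, conicUnion, Set.mem_iUnion]
    tauto

theorem sum_ite_mem_eq {α : Type*} {X P : Set α} (hX : X.Finite) (hP : P ⊆ X)
    [DecidablePred (· ∈ P)] (a : ℤ) :
    ∑ t ∈ hX.toFinset, (if t ∈ P then a else 0) = P.ncard * a := by
  rw [← Finset.sum_filter, Finset.sum_const, nsmul_eq_mul, ← Set.ncard_coe_finset]
  congr 3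
  ext t
  simp only [Finset.coe_filter, Set.Finite.mem_toFinset, Set.mem_ofPred_eq]
  exact ⟨fun h => h.2, fun h => ⟨hP h, h⟩⟩

theorem ncard_inter_conicUnion (hF : Nat.card F = p ^ 2) :
    ((fermatCurve k p ∩ conicUnion F k).ncard : ℤ) =
      (p : ℤ) ^ 11 + 2 * (p : ℤ) ^ 8 + 2 * (p : ℤ) ^ 6 + 3 * (p : ℤ) ^ 5 + (p : ℤ) ^ 4
        + 2 * (p : ℤ) ^ 3 + (p : ℤ) ^ 2 + 2 * (p : ℤ) + 2 - (totalError F k p : ℤ) := by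
  classical
  have := finite_conic (F := F)
  have := Fintype.ofFinite (Conic F)
  have hX := finite_inter_conicUnion F k p
  set P1 := rationalPoints k p (p ^ 2) with hP1
  set P3 := rationalPoints k p (p ^ 6) with hP3
  set P4 := rationalPoints k p (p ^ 8) with hP4
  have h13 : P1 ⊆ P3 := rationalPoints_subset (n := 3)
  have h14 : P1 ⊆ P4 := rationalPoints_subset (n := 4)
  have h34 : ∀ t, t ∈ P3 → t ∈ P4 → t ∈ P1 := fun t h3 h4 =>
    ⟨h3.1, FrobFixed.of_three_of_four t.rep_nonzero h3.2 h4.2⟩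
  have hN := fun t : Plane k => ncard_conics_through (F := F) t
  have hmemX : ∀ t ∈ fermatCurve k p, {Q : Conic F | t ∈ Q.points k}.ncard ≠ 0 →
      t ∈ fermatCurve k p ∩ conicUnion F k := by
    intro t ht h
    obtain ⟨Q, hQ⟩ := Set.nonempty_of_ncard_ne_zero h
    exact ⟨ht, Set.mem_iUnion.2 ⟨Q, hQ⟩⟩
  have hN1 : ∀ t ∈ P1, {Q : Conic F | t ∈ Q.points k}.ncard =
      1 + p ^ 2 + p ^ 4 + p ^ 6 + p ^ 8 := by
    intro t ht
    rw [hN, finrank_ker_of_one hF ht, hF]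
    simp only [Finset.sum_range_succ, Finset.sum_range_zero]
    ring
  have hN3 : ∀ t ∈ P3 \ P1, {Q : Conic F | t ∈ Q.points k}.ncard = 1 + p ^ 2 + p ^ 4 := by
    intro t ht
    rw [hN, finrank_ker_of_three hF ht.1 ht.2, hF]
    simp only [Finset.sum_range_succ, Finset.sum_range_zero]
    ring
  have hN4 : ∀ t ∈ P4 \ P1, {Q : Conic F | t ∈ Q.points k}.ncard = 1 + p ^ 2 := by
    intro t ht
    rw [hN, finrank_ker_of_four hF ht.1 ht.2, hF]
    simp only [Finset.sum_range_succ, Finset.sum_range_zero]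
    ring
  have hsub1 : P1 ⊆ fermatCurve k p ∩ conicUnion F k := fun t ht =>
    hmemX t ht.1 (by rw [hN1 t ht]; omega)
  have hsub3 : P3 \ P1 ⊆ fermatCurve k p ∩ conicUnion F k := fun t ht =>
    hmemX t ht.1.1 (by rw [hN3 t ht]; omega)
  have hsub4 : P4 \ P1 ⊆ fermatCurve k p ∩ conicUnion F k := fun t ht =>
    hmemX t ht.1.1 (by rw [hN4 t ht]; omega)
  -- Each point of C ∩ Δ counts once, plus its excess; `P3 \ P1` and `P4 \ P1` are disjoint by
  -- `h34`.
  have hval : ∀ t ∈ hX.toFinset, ({Q : Conic F | t ∈ Q.points k}.ncard : ℤ) =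
      1 + (if t ∈ P1 then (p ^ 2 + p ^ 4 + p ^ 6 + p ^ 8 : ℤ) else 0) +
        (if t ∈ P3 \ P1 then (p ^ 2 + p ^ 4 : ℤ) else 0) +
        (if t ∈ P4 \ P1 then (p ^ 2 : ℤ) else 0) := by
    intro t ht
    rw [Set.Finite.mem_toFinset] at ht
    by_cases h1 : t ∈ P1
    · rw [hN1 t h1, if_pos h1, if_neg fun h => h.2 h1, if_neg fun h => h.2 h1]
      push_cast
      ring
    by_cases h3 : t ∈ P3
    · rw [hN3 t ⟨h3, h1⟩, if_neg h1, if_pos ⟨h3, h1⟩, if_neg fun h => h1 (h34 t h3 h.1)]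
      push_cast
      ring
    by_cases h4 : t ∈ P4
    · rw [hN4 t ⟨h4, h1⟩, if_neg h1, if_neg fun h => h3 h.1, if_pos ⟨h4, h1⟩]
      push_cast
      ring
    rw [if_neg h1, if_neg fun h => h3 h.1, if_neg fun h => h4 h.1]
    have hle := finrank_ker_le_one hF ht.1 h1 h3 h4
    obtain ⟨Q, hQ⟩ := Set.mem_iUnion.1 ht.2
    have hfin : {Q : Conic F | t ∈ Q.points k}.Finite := Set.toFinite _
    have hpos := (Set.ncard_pos hfin).2 ⟨Q, hQ⟩
    rw [hN] at hpos ⊢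
    -- Dimension 0 is excluded because `t` lies on some conic, so exactly one conic passes through
    -- it.
    interval_cases h : Module.finrank F (LinearMap.ker (quadEval F t.rep))
    · simp at hpos
    · simp
  have hdc := sum_ncard_inter_points (F := F) (k := k) (p := p)
  have hbez : ∑ Q : Conic F, ((fermatCurve k p ∩ Q.points k).ncard + conicError k p Q) =
      (1 + p ^ 2 + p ^ 4 + p ^ 6 + p ^ 8 + p ^ 10) * (2 * (p + 1)) := by
    rw [Finset.sum_congr rfl fun Q _ => ncard_inter_points_add_conicError Q, Finset.sum_const,
      Finset.card_univ, ← Nat.card_eq_fintype_card, card_conic, hF, smul_eq_mul]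
    simp only [Finset.sum_range_succ, Finset.sum_range_zero]
    ring
  rw [Finset.sum_add_distrib, ← finsum_eq_sum_of_fintype (fun Q => conicError k p Q), hdc] at hbez
  change _ + totalError F k p = _ at hbez
  have hbez' := congrArg (Nat.cast : ℕ → ℤ) hbez
  push_cast at hbez'
  rw [Finset.sum_congr rfl hval, Finset.sum_add_distrib, Finset.sum_add_distrib,
    Finset.sum_add_distrib, sum_ite_mem_eq hX hsub1, sum_ite_mem_eq hX hsub3,
    sum_ite_mem_eq hX hsub4, Finset.sum_const, nsmul_eq_mul, mul_one,
    ← Set.ncard_eq_toFinset_card _ hX] at hbez'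
  have c1 := ncard_rationalPoints (k := k) (p := p) (n := 1) one_ne_zero
  have c3 := ncard_rationalPoints (k := k) (p := p) (n := 3) (by norm_num)
  have c4 := ncard_rationalPoints (k := k) (p := p) (n := 4) (by norm_num)
  simp only [Nat.reduceMul, Nat.reduceAdd] at c1 c3 c4
  rw [← hP1] at c1
  rw [← hP3] at c3
  rw [← hP4] at c4
  have hf1 : P1.Finite := hX.subset hsub1
  have d3 : ((P3 \ P1).ncard : ℤ) + P1.ncard = P3.ncard := by
    exact_mod_cast Set.ncard_sdiff_add_ncard_of_subset h13
      (by rw [← Set.sdiff_union_of_subset h13]; exact (hX.subset hsub3).union hf1)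
  have d4 : ((P4 \ P1).ncard : ℤ) + P1.ncard = P4.ncard := by
    exact_mod_cast Set.ncard_sdiff_add_ncard_of_subset h14
      (by rw [← Set.sdiff_union_of_subset h14]; exact (hX.subset hsub4).union hf1)
  rw [c1, c3] at d3
  rw [c1, c4] at d4
  rw [c1, eq_sub_of_add_eq d3, eq_sub_of_add_eq d4] at hbez'
  linear_combination hbez'

end DoubleCounting

/-! ### Asymptotics along the primes. -/

theorem isLittleO_remainder :
    (fun p : Nat.Primes => (2 * (p : ℝ) ^ 8 + 2 * (p : ℝ) ^ 6 + 3 * (p : ℝ) ^ 5 + (p : ℝ) ^ 4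
      + 2 * (p : ℝ) ^ 3 + (p : ℝ) ^ 2 + 2 * (p : ℝ) + 2))
      =o[comap (fun p : Nat.Primes => (p : ℕ)) atTop] (fun p : Nat.Primes => (p : ℝ) ^ 11) := by
  have hreal : (fun x : ℝ => 2 * x ^ 8 + 2 * x ^ 6 + 3 * x ^ 5 + x ^ 4 + 2 * x ^ 3 + x ^ 2 + 2 * x
      + 2) =o[atTop] fun x : ℝ => x ^ 11 := by
    have h : ∀ n, n < 11 → ∀ c : ℝ, (fun x : ℝ => c * x ^ n) =o[atTop] fun x : ℝ => x ^ 11 :=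
      fun n hn c => (isLittleO_pow_pow_atTop_of_lt hn).const_mul_left c
    have := (((((((h 8 (by norm_num) 2).add (h 6 (by norm_num) 2)).add (h 5 (by norm_num) 3)).add
      (h 4 (by norm_num) 1)).add (h 3 (by norm_num) 2)).add (h 2 (by norm_num) 1)).add
      (h 1 (by norm_num) 2)).add (h 0 (by norm_num) 2)
    simpa using this
  exact hreal.comp_tendsto (tendsto_natCast_atTop_atTop.comp tendsto_comap)

end FermatConics

theorem mainTheorem10 (k : Nat.Primes → Type*) [∀ p, Field (k p)] [∀ p, IsAlgClosed (k p)]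
    [∀ p : Nat.Primes, Algebra (GaloisField p 2) (k p)] :
    (∀ p : Nat.Primes,
      (FermatConics.fermatCurve (k p) p ∩
        FermatConics.conicUnion (GaloisField p 2) (k p)).Finite ∧
      (∀ (Q : FermatConics.Conic (GaloisField p 2)) (t : FermatConics.Plane (k p)),
        t ∈ FermatConics.fermatCurve (k p) p ∩ Q.points (k p) →
        FermatConics.intersectionMult (FermatConics.fermatForm (k p) p) (Q.form (k p)) t ≠ ⊤) ∧
      ((FermatConics.fermatCurve (k p) p ∩
          FermatConics.conicUnion (GaloisField p 2) (k p)).ncard : ℤ) =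
        (p : ℤ) ^ 11 + 2 * (p : ℤ) ^ 8 + 2 * (p : ℤ) ^ 6 + 3 * (p : ℤ) ^ 5 + (p : ℤ) ^ 4
          + 2 * (p : ℤ) ^ 3 + (p : ℤ) ^ 2 + 2 * (p : ℤ) + 2
          - (FermatConics.totalError (GaloisField p 2) (k p) p : ℤ)) ∧
    (fun p : Nat.Primes =>
        ((FermatConics.fermatCurve (k p) p ∩
          FermatConics.conicUnion (GaloisField p 2) (k p)).ncard : ℝ)
        - ((p : ℝ) ^ 11 - (FermatConics.totalError (GaloisField p 2) (k p) p : ℝ)))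
      =o[comap (fun p : Nat.Primes => (p : ℕ)) atTop] (fun p : Nat.Primes => (p : ℝ) ^ 11) := by
  have hchar : ∀ p : Nat.Primes, CharP (k p) p := fun p =>
    charP_of_injective_algebraMap (algebraMap (GaloisField p 2) (k p)).injective p
  have hcount := fun p : Nat.Primes =>
    FermatConics.ncard_inter_conicUnion (F := GaloisField p 2) (k := k p)
      (GaloisField.card p 2 two_ne_zero)
  refine ⟨fun p => ⟨FermatConics.finite_inter_conicUnion _ _ _, fun Q t _ =>
    FermatConics.intersectionMult_form_ne_top Q t, hcount p⟩, ?_⟩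
  refine FermatConics.isLittleO_remainder.congr_left fun p => ?_
  have h := congrArg (Int.cast : ℤ → ℝ) (hcount p)
  push_cast at h
  rw [h]
  ring
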